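/- Let $d\ge 1$ be an integer, let $s>0$ be real, and let $\gamma$ be the standard Gaussian measure on $\mathbb R^d$, with density $(2\pi)^{-d/2}e^{-|x|^2/2}$. All functions are real-valued, and $|\alpha|_1=\alpha_1+\dots+\alpha_d$ for $\alpha\in\mathbb N_0^d$. *Sobolev spaces.* For $m\in\mathbb N_0$, $W^m_2(\mathbb R^d,\gamma)$ is the space of all $f\in L_2(\mathbb R^d,\gamma)$ whose weak derivatives $D^\alpha f$, $|\alpha|_1\le m$, belong to $L_2(\mathbb R^d,\gamma)$, with the norm $\|f\|_{W^m_2}=\big(\sum_{|\alpha|_1\le m}\|D^\alpha f\|^2_{L_2(\mathbb R^d,\gamma)}\big)^{1/2}$. For $s>0$, $s\notin\mathbb N$, write $s=\bar s+\tilde s$ with $\bar s=\lfloor s\rfloor$. Then $W^s_2(\mathbb R^d,\gamma)$ is the space of all $f\in W^{\bar s}_2(\mathbb R^d,\gamma)$ with $[f]_s<\infty$, with the norm $\|f\|_{W^s_2}=\|f\|_{W^{\bar s}_2}+[f]_s$, where $$[f]_s=\sum_{|\alpha|_1=\bar s}\Big(\int_{\mathbb R^d}\int_{\mathbb R^d}|D^\alpha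 f(x)-D^\alpha f(y)|^2K_{2\tilde s}(x,y)\,d\gamma(x)\,d\gamma(y)\Big)^{1/2},\qquad K_\sigma(x,y)=\int_0^\infty \frac{M_t(x,y)}{t^{\sigma/2+1}}\,dt,$$ and $$M_t(x,y)=(1-e^{-2t})^{-d/2}\exp\Big(-\frac{e^{-2t}|x|^2-2e^{-t}x\cdot y+e^{-2t}|y|^2}{2(1-e^{-2t})}\Big)$$ is the Mehler kernel. *Hermite spaces.* Let $H_k(x)=\frac{(-1)^k}{\sqrt{k!}}e^{x^2/2}\frac{d^k}{dx^k}e^{-x^2/2}$ for $k\in\mathbb N_0$, let $H_{\mathbf k}(x)=\prod_{j=1}^dH_{k_j}(x_j)$ for $\mathbf k\in\mathbb N_0^d$, and let $\widehat f(\mathbf k)=\int fH_{\mathbf k}\,d\gamma$. Then $H^s(\mathbb R^d,\gamma)$ is the space of all $f\in L_2(\mathbb R^d,\gamma)$ with $\|f\|_{H^s}=\big(\sum_{\mathbf k\in\mathbb N_0^d}(1+|\mathbf k|_1)^s|\widehat f(\mathbf k)|^2\big)^{1/2}<\infty$. *Widths.* For a subset $F$ of a Banach space $Y$ let $$d_n(F,Y)=\inf_{L}\sup_{f\in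 F}\inf_{g\in L}\|f-g\|_Y,\qquad \lambda_n(F,Y)=\inf_A\sup_{f\in F}\|f-Af\|_Y,$$ where $L$ runs over the linear subspaces of $Y$ of dimension at most $n$ and $A$ over the linear operators $Y\to Y$ of rank at most $n$. Write $a_n\asymp b_n$ if there is a finite constant $C>0$, independent of $n$, with $a_n\le Cb_n$ and $b_n\le Ca_n$ for all $n\ge1$. **Theorem.** Let $\boldsymbol W^s_2$ and $\boldsymbol H^s$ be the closed unit balls of $W^s_2(\mathbb R^d,\gamma)$ and $H^s(\mathbb R^d,\gamma)$, and let $Y=L_2(\mathbb R^d,\gamma)$. Then $d_n(\boldsymbol W^s_2,Y)=\lambda_n(\boldsymbol W^s_2,Y)$ and $d_n(\boldsymbol H^s,Y)=\lambda_n(\boldsymbol H^s,Y)$ for all $n$. For each of the two choices $s_n=d_n$ and $s_n=\lambda_n$, $$s_n(\boldsymbol W^s_2,Y)\asymp s_n(\boldsymbol H^s,Y)\asymp n^{-\frac{s}{2d}},$$ and $$\lim_{n\to\infty}\frac{s_n(\boldsymbol H^s,Y)}{n^{-s/(2d)}}=\Big(\frac1{\sqrt[d]{d!}}\Big)^{s/2}.$$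 -/

import Mathlib

open MeasureTheory Filter Topology
open scoped ENNReal NNReal Nat ContDiff

noncomputable section

namespace GaussianSobolev

/-! ### Widths -/

section Widths

variable {Y : Type*} [NormedAddCommGroup Y] [NormedSpace ℝ Y]

/-- Kolmogorov width: the infimum over all subspaces `L` of dimension at most `n` of
`sup_{f ∈ F} inf_{g ∈ L} ‖f - g‖`, as an extended nonnegative number. -/
def kolmogorovWidth (F : Set Y) (n : ℕ) : ℝ≥0∞ :=
  ⨅ (L : Submodule ℝ Y) (_ : Module.rank ℝ L ≤ (n : Cardinal)),
    ⨆ f ∈ F, ⨅ g : L, ‖f - (g : Y)‖ₑ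

/-- Linear width: the infimum over all linear operators `A : Y → Y` of rank at most `n` of
`sup_{f ∈ F} ‖f - A f‖`, as an extended nonnegative number. -/
def linearWidth (F : Set Y) (n : ℕ) : ℝ≥0∞ :=
  ⨅ (A : Y →ₗ[ℝ] Y) (_ : A.rank ≤ (n : Cardinal)),
    ⨆ f ∈ F, ‖f - A f‖ₑ

end Widths

/-- `a_n ≍ b_n`: two-sided estimate for all `n ≥ 1`, with a finite constant independent of `n`. -/
def AsympOrder (a b : ℕ → ℝ≥0∞) : Prop :=
  ∃ C : ℝ≥0, 0 < C ∧ ∀ n : ℕ, 1 ≤ n → a n ≤ C * b n ∧ b n ≤ C * a n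

/-! ### The Gaussian Lebesgue space -/

/-- The density `(2π)^{-d/2} exp(-|x|²/2)`. -/
def gaussianDensity (d : ℕ) (x : EuclideanSpace ℝ (Fin d)) : ℝ :=
  (2 * Real.pi) ^ (-(d : ℝ) / 2) * Real.exp (-‖x‖ ^ 2 / 2)

/-- The standard Gaussian measure `γ` on `ℝ^d`. -/
def gaussianMeasure (d : ℕ) : Measure (EuclideanSpace ℝ (Fin d)) :=
  volume.withDensity fun x => ENNReal.ofReal (gaussianDensity d x)

/-- The space `L_2(ℝ^d, γ)`. -/
abbrev L2Gaussian (d : ℕ) : Type :=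
  Lp ℝ 2 (gaussianMeasure d)

/-! ### Weak derivatives -/

/-- The classical partial derivative `∂_i u`. -/
def partialDeriv {d : ℕ} (i : Fin d) (u : EuclideanSpace ℝ (Fin d) → ℝ) :
    EuclideanSpace ℝ (Fin d) → ℝ :=
  fun x => fderiv ℝ u x (EuclideanSpace.single i 1)

/-- The classical derivative `D^α u = ∂_1^{α_1} ⋯ ∂_d^{α_d} u`. -/
def multiDeriv {d : ℕ} (α : Fin d → ℕ) (u : EuclideanSpace ℝ (Fin d) → ℝ) :
    EuclideanSpace ℝ (Fin d) → ℝ :=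
  (List.finRange d).foldr (fun i ψ => (partialDeriv i)^[α i] ψ) u

/-- `g` is the generalized (weak) derivative `D^α f` of `f` on `ℝ^d`. Elements of `L_2(ℝ^d, γ)`
are locally integrable with respect to Lebesgue measure, so both integrals converge. -/
def HasWeakDeriv {d : ℕ} (α : Fin d → ℕ) (f g : L2Gaussian d) : Prop :=
  ∀ u : EuclideanSpace ℝ (Fin d) → ℝ, ContDiff ℝ ((⊤ : ℕ∞) : WithTop ℕ∞) u → HasCompactSupport u →
    ∫ x, f x * multiDeriv α u x = (-1) ^ (∑ i, α i) * ∫ x, g x * u x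

open Classical in
/-- The generalized derivative `D^α f` if it exists and lies in `L_2(ℝ^d, γ)`, and `0` otherwise. -/
def weakDeriv {d : ℕ} (α : Fin d → ℕ) (f : L2Gaussian d) : L2Gaussian d :=
  if h : ∃ g, HasWeakDeriv α f g then h.choose else 0

/-! ### Gaussian Sobolev spaces with exponent `2` -/

/-- The set of functions in `W^m_2(ℝ^d, γ)`, for a nonnegative integer `m`. -/
def intSobolevSpace (d m : ℕ) : Set (L2Gaussian d) :=
  {f | ∀ α : Fin d → ℕ, ∑ i, α i ≤ m → ∃ g, HasWeakDeriv α f g}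

/-- The norm of `W^m_2(ℝ^d, γ)`, meaningful on `intSobolevSpace d m`:
`(∑_{|α|_1 ≤ m} ‖D^α f‖²)^{1/2}`. -/
def intSobolevNorm (d m : ℕ) (f : L2Gaussian d) : ℝ≥0∞ :=
  (∑ k ∈ Finset.range (m + 1), ∑ α ∈ (Finset.univ : Finset (Fin d)).piAntidiag k,
    ‖weakDeriv α f‖ₑ ^ (2 : ℝ)) ^ (1 / 2 : ℝ)

/-- The Mehler kernel `M_t(x, y)`. -/
def mehlerKernel {d : ℕ} (t : ℝ) (x y : EuclideanSpace ℝ (Fin d)) : ℝ :=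
  1 / (1 - Real.exp (-2 * t)) ^ ((d : ℝ) / 2) *
    Real.exp (-(Real.exp (-2 * t) * ‖x‖ ^ 2 - 2 * Real.exp (-t) * inner ℝ x y
      + Real.exp (-2 * t) * ‖y‖ ^ 2) / (2 * (1 - Real.exp (-2 * t))))

/-- The kernel `K_σ(x, y) = ∫_0^∞ M_t(x, y) / t^{σ/2 + 1} dt`. -/
def fracKernel {d : ℕ} (σ : ℝ) (x y : EuclideanSpace ℝ (Fin d)) : ℝ≥0∞ :=
  ∫⁻ t in Set.Ioi (0 : ℝ), ENNReal.ofReal (mehlerKernel t x y / t ^ (σ / 2 + 1))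

/-- The seminorm `[f]` of `W^s_2(ℝ^d, γ)` for noninteger `s`, where `⌊s⌋₊` and `Int.fract s` are
the integer and the fractional part of `s`. -/
def fracSeminorm (d : ℕ) (s : ℝ) (f : L2Gaussian d) : ℝ≥0∞ :=
  ∑ α ∈ (Finset.univ : Finset (Fin d)).piAntidiag ⌊s⌋₊,
    (∫⁻ y, ∫⁻ x, ‖weakDeriv α f x - weakDeriv α f y‖ₑ ^ (2 : ℝ) *
      fracKernel (2 * Int.fract s) x y ∂gaussianMeasure d ∂gaussianMeasure d) ^ (1 / 2 : ℝ)

/-- The set of functions in `W^s_2(ℝ^d, γ)`, for real `s > 0`. -/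
def sobolevSpace (d : ℕ) (s : ℝ) : Set (L2Gaussian d) :=
  {f | f ∈ intSobolevSpace d ⌊s⌋₊ ∧ (Int.fract s ≠ 0 → fracSeminorm d s f < ⊤)}

open Classical in
/-- The norm of `W^s_2(ℝ^d, γ)`, for real `s > 0`, meaningful on `sobolevSpace d s`. -/
def sobolevNorm (d : ℕ) (s : ℝ) (f : L2Gaussian d) : ℝ≥0∞ :=
  if Int.fract s = 0 then intSobolevNorm d ⌊s⌋₊ f
  else intSobolevNorm d ⌊s⌋₊ f + fracSeminorm d s f

/-- The closed unit ball of `W^s_2(ℝ^d, γ)`. -/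
def sobolevBall (d : ℕ) (s : ℝ) : Set (L2Gaussian d) :=
  {f | f ∈ sobolevSpace d s ∧ sobolevNorm d s f ≤ 1}

/-! ### The Hermite-defined spaces -/

/-- The normalized probabilists' Hermite polynomial `H_k`. -/
def hermiteFun (k : ℕ) (x : ℝ) : ℝ :=
  Polynomial.aeval x (Polynomial.hermite k) / √(k ! : ℝ)

theorem hermiteFun_eq (k : ℕ) (x : ℝ) :
    hermiteFun k x = (-1) ^ k / √(k ! : ℝ) * Real.exp (x ^ 2 / 2) *
      iteratedDeriv k (fun y => Real.exp (-(y ^ 2 / 2))) x := by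
  rw [hermiteFun, Polynomial.hermite_eq_deriv_gaussian', iteratedDeriv_eq_iterate]
  ring

/-- The `d`-variate Hermite polynomial `H_k(x) = ∏_j H_{k_j}(x_j)`. -/
def multiHermite {d : ℕ} (k : Fin d → ℕ) (x : EuclideanSpace ℝ (Fin d)) : ℝ :=
  ∏ j, hermiteFun (k j) (x j)

/-- The Hermite coefficient `f̂(k) = ∫ f H_k dγ`. -/
def hermiteCoeff {d : ℕ} (f : L2Gaussian d) (k : Fin d → ℕ) : ℝ :=
  ∫ x, f x * multiHermite k x ∂gaussianMeasure d

/-- The norm of `H^s(ℝ^d, γ)`: `(∑_k (1 + |k|_1)^s |f̂(k)|²)^{1/2}`, with value `∞` off the space. -/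
def hermiteNorm (d : ℕ) (s : ℝ) (f : L2Gaussian d) : ℝ≥0∞ :=
  (∑' k : Fin d → ℕ, ENNReal.ofReal ((1 + ∑ i, (k i : ℝ)) ^ s * |hermiteCoeff f k| ^ 2))
    ^ (1 / 2 : ℝ)

/-- The set of functions in `H^s(ℝ^d, γ)`. -/
def hermiteSpace (d : ℕ) (s : ℝ) : Set (L2Gaussian d) :=
  {f | hermiteNorm d s f < ⊤}

/-- The closed unit ball of `H^s(ℝ^d, γ)`. -/
def hermiteBall (d : ℕ) (s : ℝ) : Set (L2Gaussian d) :=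
  {f | f ∈ hermiteSpace d s ∧ hermiteNorm d s f ≤ 1}

end GaussianSobolev

end

namespace GaussianSobolev

/-! ### One-dimensional Hermite polynomials and Gaussian measures -/

open Polynomial ProbabilityTheory

/-! The Hermite polynomials are an orthonormal basis of L_2(γ), so the unit ball of H^s is an
ellipsoid with semi-axes (1+|k|_1)^{-s/2}. In a Hilbert space the n-th width of an ellipsoid is its
(n+1)-st largest semi-axis. Orthogonal projection onto the first n axes gives the upper bound
(`kolmogorovWidth_le`). A ball inside an (n+1)-dimensional section gives the lower bound
(`ofReal_le_kolmogorovWidth`, `le_kolmogorovWidth`). There are binom(M+d, d) ~ M^d/d! multi-indices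
with |k|_1 ≤ M, so the relevant degree M = `widthOrder d n` satisfies M ~ (d! n)^{1/d}. This yields
both the order and the limit.

The Sobolev ball is compared with multiples of the Hermite ball. Integration by parts against H_k
times the Gaussian density shows that D^α shifts Hermite coefficients, so ‖D^α f‖² is the sum of
k!/(k-α)! · f̂(k)² (`hermiteCoeff_weakDeriv`). For the fractional seminorm, M_t is the transition
kernel of the Ornstein–Uhlenbeck semigroup, with eigenvalue e^{-t|k|} on H_k. Hence the integral of
|g(x)-g(y)|² M_t(x,y) is the sum of 2(1-e^{-t|k|}) ĝ(k)², and integration against t^{-θ-1} dt turns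
the weight into a constant times |k|^θ (`lintegral_enorm_sub_sq_mul_fracKernel`). All weights are
therefore comparable to (1+|k|)^s.

The widths need only two inclusions: the Hermite norm is bounded on the Sobolev ball
(`exists_hermiteNorm_le_of_mem_sobolevBall`), and polynomials of small Hermite norm lie in the
Sobolev ball (`exists_mem_sobolevBall_of_hermiteNorm_le`). Equality of the two spaces is never
needed. Kolmogorov and linear widths agree because orthogonal projection is a linear best
approximation. -/

theorem derivative_hermite_succ (n : ℕ) :
    derivative (hermite (n + 1)) = ((n : ℤ[X]) + 1) * hermite n := by
  induction n with
  | zero => simp [hermite_zero]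
  | succ n ih =>
    rw [hermite_succ (n + 1), derivative_sub, derivative_mul, ih, derivative_X, derivative_mul,
      hermite_succ n]
    have h1 : derivative ((n : ℤ[X]) + 1) = 0 := by simp
    rw [h1]
    push_cast
    ring

theorem integrable_eval_gaussianReal (p : ℝ[X]) (μ : ℝ) (v : ℝ≥0) :
    Integrable (fun x => p.eval x) (gaussianReal μ v) := by
  simp_rw [eval_eq_sum_range]
  refine integrable_finsetSum _ fun i _ => Integrable.const_mul ?_ _
  have := (memLp_id_gaussianReal' (μ := μ) (v := v) (i : ℝ≥0∞) (by simp)).integrable_norm_pow'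
  have h2 := this
  simp only [id] at h2
  refine (integrable_norm_iff ?_).1 ?_
  · exact (continuous_pow i).aestronglyMeasurable
  · simpa [norm_pow] using h2

theorem integrable_eval_mul_gaussianPDFReal (p : ℝ[X]) (μ : ℝ) {v : ℝ≥0} (hv : v ≠ 0) :
    Integrable (fun x => p.eval x * gaussianPDFReal μ v x) := by
  have := integrable_eval_gaussianReal p μ v
  rw [gaussianReal_of_var_ne_zero _ hv,
    integrable_withDensity_iff_integrable_smul' (measurable_gaussianPDF μ v)
      (ae_of_all _ fun x => gaussianPDF_lt_top)] at this
  refine this.congr (ae_of_all _ fun x => ?_)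
  simp [toReal_gaussianPDF, mul_comm]

theorem hasDerivAt_gaussianPDFReal (μ : ℝ) {v : ℝ≥0} (hv : v ≠ 0) (x : ℝ) :
    HasDerivAt (gaussianPDFReal μ v) (-((x - μ) / v) * gaussianPDFReal μ v x) x := by
  have hv' : (v : ℝ) ≠ 0 := by exact_mod_cast hv
  have h1 : HasDerivAt (fun x : ℝ => -(x - μ) ^ 2 / (2 * v)) (-((x - μ) / v)) x := by
    have := ((((hasDerivAt_id x).sub_const μ).pow 2).neg).div_const (2 * (v : ℝ))
    refine this.congr_deriv ?_
    simp
    field_simp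
  have h2 := (h1.exp).const_mul ((√(2 * Real.pi * v))⁻¹)
  rw [gaussianPDFReal_def]
  refine h2.congr_deriv ?_
  simp only
  ring

/-- Gaussian integration by parts for polynomials. -/
theorem integral_sub_mul_eval_gaussianReal (p : ℝ[X]) (μ : ℝ) {v : ℝ≥0} (hv : v ≠ 0) :
    ∫ x, (x - μ) * p.eval x ∂gaussianReal μ v =
      v * ∫ x, (derivative p).eval x ∂gaussianReal μ v := by
  have hv' : (v : ℝ) ≠ 0 := by exact_mod_cast hv
  have hd : ∀ x, HasDerivAt (fun x => p.eval x * gaussianPDFReal μ v x)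
      ((derivative p).eval x * gaussianPDFReal μ v x +
        p.eval x * (-((x - μ) / v) * gaussianPDFReal μ v x)) x :=
    fun x => (p.hasDerivAt x).mul (hasDerivAt_gaussianPDFReal μ hv x)
  have h2 : ∀ x, p.eval x * (-((x - μ) / v) * gaussianPDFReal μ v x) =
      -(v : ℝ)⁻¹ * (((X - C μ) * p).eval x * gaussianPDFReal μ v x) := fun x => by
    simp; ring
  have i1 := integrable_eval_mul_gaussianPDFReal (derivative p) μ hv
  have i2 := (integrable_eval_mul_gaussianPDFReal ((X - C μ) * p) μ hv).const_mul (-(v : ℝ)⁻¹)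
  simp_rw [h2] at hd
  -- The derivative of p times the density integrates to zero; its two summands are the two sides of
  -- the identity.
  have h0 := integral_eq_zero_of_hasDerivAt_of_integrable hd (i1.add i2)
    (integrable_eval_mul_gaussianPDFReal p μ hv)
  rw [integral_add i1 i2, integral_const_mul] at h0
  simp_rw [integral_gaussianReal_eq_integral_smul hv, smul_eq_mul]
  have e1 : ∫ x, gaussianPDFReal μ v x * ((x - μ) * p.eval x) =
      ∫ x, ((X - C μ) * p).eval x * gaussianPDFReal μ v x :=
    integral_congr_ae (ae_of_all _ fun x => by simp; ring)
  have e2 : ∫ x, gaussianPDFReal μ v x * (derivative p).eval x =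
      ∫ x, (derivative p).eval x * gaussianPDFReal μ v x :=
    integral_congr_ae (ae_of_all _ fun x => by simp; ring)
  rw [e1, e2]
  field_simp at h0
  linarith

/-- The normalized Hermite polynomial, as a polynomial. -/
noncomputable def hermitePoly (k : ℕ) : ℝ[X] :=
  C ((√(k ! : ℝ))⁻¹) * (hermite k).map (Int.castRingHom ℝ)

theorem eval_hermitePoly (k : ℕ) (x : ℝ) : (hermitePoly k).eval x = hermiteFun k x := by
  simp only [hermitePoly, hermiteFun, eval_mul, eval_C, eval_map, aeval_def, div_eq_inv_mul]
  rfl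

theorem hermitePoly_zero : hermitePoly 0 = 1 := by
  simp [hermitePoly]

/-- The truncated `k - 1` is harmless at k = 0, where the factor √0 vanishes. The same convention
recurs in every lowering formula below. -/
theorem derivative_hermitePoly (k : ℕ) :
    derivative (hermitePoly k) = C (√(k : ℝ)) * hermitePoly (k - 1) := by
  cases k with
  | zero => simp [hermitePoly_zero]
  | succ k =>
    have h1 : (√((k + 1)! : ℝ))⁻¹ * ((k : ℝ) + 1) = √((k : ℝ) + 1) * (√(k ! : ℝ))⁻¹ := by
      rw [Nat.factorial_succ]
      push_cast
      rw [Real.sqrt_mul (by positivity)]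
      have : √((k : ℝ) + 1) ≠ 0 := by positivity
      have h3 : √(k ! : ℝ) ≠ 0 := by positivity
      field_simp
      rw [Real.sq_sqrt (by positivity)]
    rw [hermitePoly, derivative_C_mul, derivative_map, derivative_hermite_succ, hermitePoly,
      ← mul_assoc]
    simp only [Polynomial.map_mul, Polynomial.map_add, Polynomial.map_natCast, Polynomial.map_one,
      Nat.add_sub_cancel]
    rw [← mul_assoc, ← C_mul]
    push_cast
    rw [← h1]
    simp

theorem hermitePoly_succ (k : ℕ) :
    C (√((k : ℝ) + 1)) * hermitePoly (k + 1) = X * hermitePoly k - derivative (hermitePoly k) := by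
  have h1 : √((k : ℝ) + 1) * (√((k + 1)! : ℝ))⁻¹ = (√(k ! : ℝ))⁻¹ := by
    rw [Nat.factorial_succ]
    push_cast
    rw [Real.sqrt_mul (by positivity)]
    have : √((k : ℝ) + 1) ≠ 0 := by positivity
    have h3 : √(k ! : ℝ) ≠ 0 := by positivity
    field_simp
  rw [hermitePoly, ← mul_assoc, ← C_mul, h1, hermite_succ, hermitePoly, derivative_C_mul,
    derivative_map]
  simp only [Polynomial.map_sub, Polynomial.map_mul, map_X]
  ring

/-- The integral of a Hermite polynomial against `N(ρ x, 1 - ρ²)`. -/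
theorem integral_hermiteFun_gaussianReal (ρ x : ℝ) {v : ℝ≥0} (hv : v ≠ 0)
    (hvρ : (v : ℝ) = 1 - ρ ^ 2) (k : ℕ) :
    ∫ y, hermiteFun k y ∂gaussianReal (ρ * x) v = ρ ^ k * hermiteFun k x := by
  simp only [← eval_hermitePoly]
  -- Write yH_k = (y-ρx)H_k + ρxH_k and integrate the first term by parts with variance 1-ρ².
  -- Combined with -H_k', this leaves the coefficient -ρ².
  have key : ∀ k : ℕ, √((k : ℝ) + 1) * ∫ y, (hermitePoly (k + 1)).eval y ∂gaussianReal (ρ * x) v =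
      ρ * x * ∫ y, (hermitePoly k).eval y ∂gaussianReal (ρ * x) v -
        ρ ^ 2 * ∫ y, (derivative (hermitePoly k)).eval y ∂gaussianReal (ρ * x) v := by
    intro k
    have h1 := integral_sub_mul_eval_gaussianReal (hermitePoly k) (ρ * x) hv
    have i1 := integrable_eval_gaussianReal (hermitePoly k) (ρ * x) v
    have i2 := integrable_eval_gaussianReal ((X - C (ρ * x)) * hermitePoly k) (ρ * x) v
    have i3 := integrable_eval_gaussianReal (derivative (hermitePoly k)) (ρ * x) v
    simp only [eval_mul, eval_sub, eval_X, eval_C] at i2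
    have h2 : ∀ y, √((k : ℝ) + 1) * (hermitePoly (k + 1)).eval y =
        ((y - ρ * x) * (hermitePoly k).eval y + ρ * x * (hermitePoly k).eval y) -
          (derivative (hermitePoly k)).eval y := by
      intro y
      have := congrArg (eval y) (hermitePoly_succ k)
      simp only [eval_mul, eval_C, eval_sub, eval_X] at this
      rw [this]
      ring
    rw [← integral_const_mul]
    simp_rw [h2]
    have i4 := i1.const_mul (ρ * x)
    have i5 : Integrable (fun y => (y - ρ * x) * (hermitePoly k).eval y +
        ρ * x * (hermitePoly k).eval y) (gaussianReal (ρ * x) v) := i2.add i4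
    rw [integral_sub i5 i3, integral_add i2 i4,
      integral_const_mul, h1, hvρ]
    ring
  have hrec : ∀ k : ℕ, √((k : ℝ) + 1) * (hermitePoly (k + 1)).eval x =
      x * (hermitePoly k).eval x - (derivative (hermitePoly k)).eval x := by
    intro k
    simpa only [eval_mul, eval_C, eval_sub, eval_X] using congrArg (eval x) (hermitePoly_succ k)
  -- Strong induction, because H_k' brings in degree k-1; the factor ρ² supplies the two powers of ρ
  -- missing there.
  induction k using Nat.strong_induction_on with
  | _ k ih =>
    cases k with
    | zero => simp [hermitePoly_zero]
    | succ k =>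
      have hs : √((k : ℝ) + 1) ≠ 0 := by positivity
      apply mul_left_cancel₀ hs
      rw [key k, ih k (Nat.lt_succ_self k), mul_left_comm (√((k : ℝ) + 1)), hrec k, derivative_hermitePoly]
      simp only [eval_mul, eval_C]
      rw [integral_const_mul, ih (k - 1) (by omega)]
      cases k with
      | zero => simp; ring
      | succ k => simp only [Nat.add_sub_cancel]; ring

/-- The operator x - d/dx, which raises H_j, is adjoint to d/dx, which lowers H_k. So both indices
drop together until one of them is zero. -/
theorem integral_hermiteFun_mul_hermiteFun (j k : ℕ) :
    ∫ x, hermiteFun j x * hermiteFun k x ∂gaussianReal 0 1 = if j = k then 1 else 0 := by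
  simp only [← eval_hermitePoly]
  have key : ∀ j k : ℕ, √((j : ℝ) + 1) *
      ∫ x, (hermitePoly (j + 1)).eval x * (hermitePoly k).eval x ∂gaussianReal 0 1 =
      √(k : ℝ) * ∫ x, (hermitePoly j).eval x * (hermitePoly (k - 1)).eval x
        ∂gaussianReal 0 1 := by
    intro j k
    have h1 := integral_sub_mul_eval_gaussianReal (hermitePoly j * hermitePoly k) 0 one_ne_zero
    have i2 := integrable_eval_gaussianReal ((X - C 0) * (hermitePoly j * hermitePoly k)) 0 1
    have i3 := integrable_eval_gaussianReal (derivative (hermitePoly j) * hermitePoly k) 0 1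
    have i4 := integrable_eval_gaussianReal (hermitePoly j * hermitePoly (k - 1)) 0 1
    have h3 : ∀ x, (derivative (hermitePoly j * hermitePoly k)).eval x =
        (derivative (hermitePoly j) * hermitePoly k).eval x +
          √(k : ℝ) * (hermitePoly j * hermitePoly (k - 1)).eval x := by
      intro x
      rw [derivative_mul, derivative_hermitePoly k]
      simp only [eval_mul, eval_add, eval_C]
      ring
    have h2 : ∀ x, √((j : ℝ) + 1) * ((hermitePoly (j + 1)).eval x * (hermitePoly k).eval x) =
        ((X - C 0) * (hermitePoly j * hermitePoly k)).eval x -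
          (derivative (hermitePoly j) * hermitePoly k).eval x := by
      intro x
      have := congrArg (eval x) (hermitePoly_succ j)
      simp only [eval_mul, eval_C, eval_sub, eval_X] at this ⊢
      rw [← mul_assoc, this]
      ring
    simp_rw [h3] at h1
    rw [integral_add i3 (i4.const_mul _), integral_const_mul] at h1
    rw [← integral_const_mul]
    simp_rw [h2]
    rw [integral_sub i2 i3]
    simp only [eval_mul, eval_sub, eval_X, eval_C, NNReal.coe_one, one_mul] at h1 ⊢
    rw [h1]
    ring
  induction j generalizing k with
  | zero =>
    -- Correlation ρ = 0 gives the plain mean of H_k under the standard Gaussian.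
    have := integral_hermiteFun_gaussianReal 0 0 one_ne_zero (by simp) k
    rw [mul_zero] at this
    simp only [← eval_hermitePoly] at this
    simp only [hermitePoly_zero, eval_one, one_mul, this]
    cases k <;> simp [hermitePoly_zero]
  | succ j ih =>
    have hs : √((j : ℝ) + 1) ≠ 0 := by positivity
    apply mul_left_cancel₀ hs
    rw [key]
    cases k with
    | zero => simp
    | succ k =>
      rw [Nat.add_sub_cancel, ih k]
      by_cases h : j = k
      · simp [h]
      · simp [h]

theorem hasDerivAt_hermiteFun (k : ℕ) (x : ℝ) :
    HasDerivAt (hermiteFun k) (√(k : ℝ) * hermiteFun (k - 1) x) x := by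
  have h := (hermitePoly k).hasDerivAt x
  rw [derivative_hermitePoly, eval_mul, eval_C, eval_hermitePoly] at h
  rwa [show (fun x => (hermitePoly k).eval x) = hermiteFun k from
    funext (eval_hermitePoly k)] at h

theorem hermiteFun_succ (k : ℕ) (x : ℝ) :
    √((k : ℝ) + 1) * hermiteFun (k + 1) x =
      x * hermiteFun k x - √(k : ℝ) * hermiteFun (k - 1) x := by
  have := congrArg (eval x) (hermitePoly_succ k)
  rw [derivative_hermitePoly] at this
  simpa only [eval_mul, eval_C, eval_sub, eval_X, eval_hermitePoly] using this

theorem contDiff_hermiteFun (k : ℕ) {n : WithTop ℕ∞} : ContDiff ℝ n (hermiteFun k) := by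
  rw [show hermiteFun k = fun x => aeval x (hermitePoly k) from
    funext fun x => by rw [← eval_hermitePoly]; simp]
  exact contDiff_aeval _ _

theorem integrable_hermiteFun_mul_hermiteFun (j k : ℕ) :
    Integrable (fun x => hermiteFun j x * hermiteFun k x) (gaussianReal 0 1) := by
  simpa only [eval_mul, eval_hermitePoly] using
    integrable_eval_gaussianReal (hermitePoly j * hermitePoly k) 0 1

end GaussianSobolev

namespace GaussianSobolev

/-! ### The multivariate Gaussian measure and Hermite polynomials -/

open ProbabilityTheory

variable {d : ℕ}

theorem gaussianDensity_pos (x : EuclideanSpace ℝ (Fin d)) : 0 < gaussianDensity d x := by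
  unfold gaussianDensity
  positivity

theorem contDiff_gaussianDensity {n : WithTop ℕ∞} : ContDiff ℝ n (gaussianDensity d) := by
  unfold gaussianDensity
  have : ContDiff ℝ n fun x : EuclideanSpace ℝ (Fin d) => ‖x‖ ^ 2 := contDiff_norm_sq ℝ
  fun_prop

theorem continuous_gaussianDensity : Continuous (gaussianDensity d) :=
  (contDiff_gaussianDensity (n := 0)).continuous

theorem gaussianDensity_eq_prod (x : EuclideanSpace ℝ (Fin d)) :
    gaussianDensity d x = ∏ i, gaussianPDFReal 0 1 (x i) := by
  simp only [gaussianDensity, gaussianPDFReal, EuclideanSpace.real_norm_sq_eq]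
  rw [Finset.prod_mul_distrib, ← Real.exp_sum]
  congr 1
  · rw [Finset.prod_const, Finset.card_univ, Fintype.card_fin, NNReal.coe_one, mul_one,
      Real.sqrt_eq_rpow, ← Real.rpow_neg (by positivity), ← Real.rpow_natCast,
      ← Real.rpow_mul (by positivity)]
    ring_nf
  · congr 1
    rw [neg_div, Finset.sum_div, ← Finset.sum_neg_distrib]
    refine Finset.sum_congr rfl fun i _ => ?_
    simp [neg_div]

theorem integrable_gaussianDensity : Integrable (gaussianDensity d) := by
  rw [show gaussianDensity d = (fun x : Fin d → ℝ => ∏ i, gaussianPDFReal 0 1 (x i)) ∘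
    (@WithLp.ofLp 2 (Fin d → ℝ)) from funext fun x => gaussianDensity_eq_prod x]
  refine (PiLp.volume_preserving_ofLp (Fin d)).integrable_comp_of_integrable ?_
  exact Integrable.fintype_prod fun i => integrable_gaussianPDFReal 0 1

theorem integral_gaussianDensity : ∫ x, gaussianDensity d x = 1 := by
  have h := (PiLp.volume_preserving_toLp (Fin d)).integral_comp
    (MeasurableEquiv.toLp 2 (Fin d → ℝ)).measurableEmbedding (gaussianDensity d)
  rw [← h]
  simp_rw [gaussianDensity_eq_prod]
  rw [integral_fintype_prod_volume_eq_prod (f := fun _ : Fin d => gaussianPDFReal 0 1)]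
  simp [integral_gaussianPDFReal_eq_one]

instance instIsProbabilityMeasureGaussianMeasure : IsProbabilityMeasure (gaussianMeasure d) := by
  constructor
  rw [gaussianMeasure, withDensity_apply _ MeasurableSet.univ, Measure.restrict_univ,
    ← ofReal_integral_eq_lintegral_ofReal integrable_gaussianDensity
      (ae_of_all _ fun x => (gaussianDensity_pos x).le), integral_gaussianDensity,
    ENNReal.ofReal_one]

theorem integral_gaussianMeasure {F : Type*} [NormedAddCommGroup F] [NormedSpace ℝ F]
    (g : EuclideanSpace ℝ (Fin d) → F) :
    ∫ x, g x ∂gaussianMeasure d = ∫ x, gaussianDensity d x • g x := by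
  rw [gaussianMeasure, integral_withDensity_eq_integral_toReal_smul
    (continuous_gaussianDensity.measurable.ennreal_ofReal) (ae_of_all _ fun x => by simp)]
  simp_rw [ENNReal.toReal_ofReal (gaussianDensity_pos _).le]

theorem integrable_gaussianMeasure_iff {g : EuclideanSpace ℝ (Fin d) → ℝ} :
    Integrable g (gaussianMeasure d) ↔ Integrable (fun x => g x * gaussianDensity d x) := by
  rw [gaussianMeasure, integrable_withDensity_iff
    (continuous_gaussianDensity.measurable.ennreal_ofReal) (ae_of_all _ fun x => by simp)]
  simp_rw [ENNReal.toReal_ofReal (gaussianDensity_pos _).le]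

/-- Weak derivatives are tested against Lebesgue measure, whereas elements of L_2(γ) are classes
modulo γ; positivity of the density lets identities pass from γ to Lebesgue measure. -/
theorem volume_absolutelyContinuous_gaussianMeasure :
    (volume : Measure (EuclideanSpace ℝ (Fin d))) ≪ gaussianMeasure d :=
  withDensity_absolutelyContinuous' continuous_gaussianDensity.measurable.ennreal_ofReal.aemeasurable
    (ae_of_all _ fun x => by simp [gaussianDensity_pos x])

theorem charFun_gaussianMeasure (t : EuclideanSpace ℝ (Fin d)) :
    charFun (gaussianMeasure d) t = Complex.exp (-‖t‖ ^ 2 / 2) := by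
  have h := GaussianFourier.integral_cexp_neg_mul_sq_norm_add (b := 1 / 2) (by norm_num)
    Complex.I t
  rw [charFun_apply, integral_gaussianMeasure]
  have e : ∀ x : EuclideanSpace ℝ (Fin d),
      gaussianDensity d x • Complex.exp (inner ℝ x t * Complex.I) =
      (((2 * Real.pi) ^ (-(d : ℝ) / 2) : ℝ) : ℂ) *
        Complex.exp (-(1 / 2) * ‖x‖ ^ 2 + Complex.I * inner ℝ t x) := by
    intro x
    rw [gaussianDensity, Complex.real_smul, Complex.exp_add]
    push_cast
    rw [real_inner_comm]
    ring_nf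
  simp_rw [e]
  rw [integral_const_mul, h, ← mul_assoc]
  have h2 : (((2 * Real.pi) ^ (-(d : ℝ) / 2) : ℝ) : ℂ) *
      (Real.pi / (1 / 2)) ^ (Module.finrank ℝ (EuclideanSpace ℝ (Fin d)) / 2 : ℂ) = 1 := by
    have : (Real.pi / (1 / 2) : ℂ) = ((2 * Real.pi : ℝ) : ℂ) := by push_cast; ring
    rw [this, finrank_euclideanSpace_fin, show ((d : ℂ) / 2) = (((d : ℝ) / 2 : ℝ) : ℂ) by push_cast; rfl,
      ← Complex.ofReal_cpow (by positivity), ← Complex.ofReal_mul, ← Real.rpow_add (by positivity)]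
    simp [neg_div]
  rw [h2, one_mul]
  congr 1
  simp
  ring

/-- Both measures have the characteristic function exp(-|t|²/2). The product form reduces integrals
of products to one dimension. -/
theorem gaussianMeasure_eq_map_pi :
    gaussianMeasure d =
      (Measure.pi fun _ : Fin d => gaussianReal 0 1).map (WithLp.toLp 2) := by
  rw [map_pi_eq_stdGaussian]
  refine Measure.ext_of_charFun (funext fun t => ?_)
  rw [charFun_gaussianMeasure, charFun_stdGaussian]

theorem measurePreserving_toLp_gaussianMeasure :
    MeasurePreserving (WithLp.toLp 2) (Measure.pi fun _ : Fin d => gaussianReal 0 1)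
      (gaussianMeasure d) :=
  ⟨(MeasurableEquiv.toLp 2 (Fin d → ℝ)).measurable, gaussianMeasure_eq_map_pi.symm⟩

theorem integral_prod_gaussianMeasure (g : Fin d → ℝ → ℝ) :
    ∫ x, ∏ i, g i (x i) ∂gaussianMeasure d = ∏ i, ∫ x, g i x ∂gaussianReal 0 1 := by
  rw [← measurePreserving_toLp_gaussianMeasure.integral_comp
    (MeasurableEquiv.toLp 2 (Fin d → ℝ)).measurableEmbedding]
  exact integral_fintype_prod_eq_prod g

theorem integrable_prod_gaussianMeasure {g : Fin d → ℝ → ℝ}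
    (hg : ∀ i, Integrable (g i) (gaussianReal 0 1)) :
    Integrable (fun x : EuclideanSpace ℝ (Fin d) => ∏ i, g i (x i)) (gaussianMeasure d) := by
  rw [← measurePreserving_toLp_gaussianMeasure.integrable_comp_emb
    (MeasurableEquiv.toLp 2 (Fin d → ℝ)).measurableEmbedding]
  exact Integrable.fintype_prod hg

theorem contDiff_multiHermite (k : Fin d → ℕ) {n : WithTop ℕ∞} :
    ContDiff ℝ n (multiHermite k) := by
  unfold multiHermite
  have h : ∀ i : Fin d, ContDiff ℝ n fun x : EuclideanSpace ℝ (Fin d) => x i :=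
    fun i => by fun_prop
  have h2 : ∀ i ∈ Finset.univ, ContDiff ℝ n
      fun x : EuclideanSpace ℝ (Fin d) => hermiteFun (k i) (x i) :=
    fun i _ => (contDiff_hermiteFun (k i)).fun_comp (h i)
  exact contDiff_prod h2

theorem continuous_multiHermite (k : Fin d → ℕ) : Continuous (multiHermite k) :=
  (contDiff_multiHermite k (n := 0)).continuous

theorem integrable_multiHermite_mul (j k : Fin d → ℕ) :
    Integrable (fun x => multiHermite j x * multiHermite k x) (gaussianMeasure d) := by
  simp only [multiHermite, ← Finset.prod_mul_distrib]
  exact integrable_prod_gaussianMeasure (g := fun i x => hermiteFun (j i) x * hermiteFun (k i) x)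
    fun i => integrable_hermiteFun_mul_hermiteFun (j i) (k i)

theorem integral_multiHermite_mul (j k : Fin d → ℕ) :
    ∫ x, multiHermite j x * multiHermite k x ∂gaussianMeasure d = if j = k then 1 else 0 := by
  simp only [multiHermite, ← Finset.prod_mul_distrib]
  rw [integral_prod_gaussianMeasure fun i x => hermiteFun (j i) x * hermiteFun (k i) x]
  simp_rw [integral_hermiteFun_mul_hermiteFun, Finset.prod_ite_zero, funext_iff]
  simp

theorem memLp_multiHermite (k : Fin d → ℕ) : MemLp (multiHermite k) 2 (gaussianMeasure d) := by
  rw [memLp_two_iff_integrable_sq (continuous_multiHermite k).aestronglyMeasurable]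
  simpa only [sq] using integrable_multiHermite_mul k k

/-- The Hermite polynomial `H_k` as an element of `L_2(γ)`. -/
noncomputable def hermiteVec (k : Fin d → ℕ) : L2Gaussian d :=
  (memLp_multiHermite k).toLp _

theorem coeFn_hermiteVec (k : Fin d → ℕ) :
    hermiteVec k =ᵐ[gaussianMeasure d] multiHermite k :=
  (memLp_multiHermite k).coeFn_toLp

theorem hermiteCoeff_eq_inner (f : L2Gaussian d) (k : Fin d → ℕ) :
    hermiteCoeff f k = inner ℝ (hermiteVec k) f := by
  rw [hermiteCoeff, L2.inner_def]
  refine integral_congr_ae ?_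
  filter_upwards [coeFn_hermiteVec k] with x hx
  simp [hx]

theorem integrable_mul_multiHermite (f : L2Gaussian d) (k : Fin d → ℕ) :
    Integrable (fun x => f x * multiHermite k x) (gaussianMeasure d) :=
  (Lp.memLp f).integrable_mul (memLp_multiHermite k)

theorem orthonormal_hermiteVec : Orthonormal ℝ (hermiteVec (d := d)) := by
  rw [orthonormal_iff_ite]
  intro j k
  rw [← hermiteCoeff_eq_inner, hermiteCoeff, ← integral_multiHermite_mul]
  refine integral_congr_ae ?_
  filter_upwards [coeFn_hermiteVec k] with x hx
  rw [hx, mul_comm]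

theorem multiHermite_eq_mul_prod_erase {k l : Fin d → ℕ} {i : Fin d} (h : ∀ j ≠ i, l j = k j)
    (x : EuclideanSpace ℝ (Fin d)) :
    multiHermite l x =
      hermiteFun (l i) (x i) * ∏ j ∈ Finset.univ.erase i, hermiteFun (k j) (x j) := by
  rw [multiHermite, ← Finset.mul_prod_erase _ _ (Finset.mem_univ i)]
  congr 1
  exact Finset.prod_congr rfl fun j hj => by rw [h j (Finset.ne_of_mem_erase hj)]

/-! ### Completeness of the Hermite polynomials in L_2(γ) -/

/-- Multiplication by a coordinate acts on Hermite polynomials by a three-term recurrence. -/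
theorem coord_mul_multiHermite (k : Fin d → ℕ) (i : Fin d) (x : EuclideanSpace ℝ (Fin d)) :
    x i * multiHermite k x = √((k i : ℝ) + 1) * multiHermite (k + Pi.single i 1) x +
      √(k i : ℝ) * multiHermite (k - Pi.single i 1) x := by
  rw [multiHermite_eq_mul_prod_erase (k := k) (l := k) (i := i) fun _ _ => rfl,
    multiHermite_eq_mul_prod_erase (k := k) (l := k + Pi.single i 1) (i := i) fun j hj => by simp [hj],
    multiHermite_eq_mul_prod_erase (k := k) (l := k - Pi.single i 1) (i := i) fun j hj => by simp [hj]]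
  simp only [Pi.add_apply, Pi.sub_apply, Pi.single_eq_same]
  rw [← mul_assoc, ← mul_assoc, ← mul_assoc, hermiteFun_succ]
  ring

/-- The three-term recurrence makes the span stable under multiplication by a linear form. The
powers of ⟨x,t⟩ are needed as Taylor terms of exp(i⟨x,t⟩). -/
theorem inner_pow_mem_span_multiHermite (t : EuclideanSpace ℝ (Fin d)) (n : ℕ) :
    (fun x => inner ℝ x t ^ n) ∈ Submodule.span ℝ (Set.range (multiHermite (d := d))) := by
  induction n with
  | zero =>
    refine Submodule.subset_span ⟨0, ?_⟩
    ext x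
    simp [multiHermite, hermiteFun]
  | succ n ih =>
    have hmul : ∀ q ∈ Submodule.span ℝ (Set.range (multiHermite (d := d))),
        (fun x : EuclideanSpace ℝ (Fin d) => q x * inner ℝ x t) ∈
          Submodule.span ℝ (Set.range (multiHermite (d := d))) := by
      intro q hq
      induction hq using Submodule.span_induction with
      | mem q hq =>
        obtain ⟨k, rfl⟩ := hq
        have : (fun x : EuclideanSpace ℝ (Fin d) => multiHermite k x * inner ℝ x t) =
            ∑ i, t i • (√((k i : ℝ) + 1) • multiHermite (k + Pi.single i 1) +
              √(k i : ℝ) • multiHermite (k - Pi.single i 1)) := by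
          ext x
          rw [PiLp.inner_apply, Finset.mul_sum, Finset.sum_apply]
          refine Finset.sum_congr rfl fun i _ => ?_
          simp only [Pi.smul_apply, Pi.add_apply, smul_eq_mul, ← coord_mul_multiHermite]
          simp
          ring
        rw [this]
        exact Submodule.sum_mem _ fun i _ => Submodule.smul_mem _ _ (Submodule.add_mem _
          (Submodule.smul_mem _ _ (Submodule.subset_span ⟨_, rfl⟩))
          (Submodule.smul_mem _ _ (Submodule.subset_span ⟨_, rfl⟩)))
      | zero =>
        simp only [Pi.zero_apply, zero_mul]
        exact Submodule.zero_mem _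
      | add p q _ _ hp hq =>
        simp only [Pi.add_apply, add_mul]
        exact Submodule.add_mem _ hp hq
      | smul c q _ hq =>
        simp only [Pi.smul_apply, smul_eq_mul, mul_assoc]
        exact Submodule.smul_mem _ c hq
    simpa only [pow_succ] using hmul _ ih

theorem integrable_exp_inner (t : EuclideanSpace ℝ (Fin d)) :
    Integrable (fun x => Real.exp (inner ℝ x t)) (gaussianMeasure d) := by
  have : (fun x : EuclideanSpace ℝ (Fin d) => Real.exp (inner ℝ x t)) =
      fun x => ∏ i, Real.exp (t i * x i) := by
    ext x
    rw [PiLp.inner_apply, Real.exp_sum]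
    simp
  rw [this]
  exact integrable_prod_gaussianMeasure (g := fun i y => Real.exp (t i * y))
    fun i => integrable_exp_mul_gaussianReal (t i)

/-- The square is at most e^{2⟨x,t⟩} + e^{-2⟨x,t⟩}. This function dominates the partial sums of the
exponential series. -/
theorem memLp_exp_abs_inner (t : EuclideanSpace ℝ (Fin d)) :
    MemLp (fun x => Real.exp |inner ℝ x t|) 2 (gaussianMeasure d) := by
  have hc : Continuous fun x : EuclideanSpace ℝ (Fin d) => Real.exp |inner ℝ x t| := by fun_prop
  rw [memLp_two_iff_integrable_sq hc.aestronglyMeasurable]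
  refine ((integrable_exp_inner ((2 : ℝ) • t)).add (integrable_exp_inner ((-2 : ℝ) • t))).mono'
    (hc.pow 2).aestronglyMeasurable (ae_of_all _ fun x => ?_)
  rw [Real.norm_of_nonneg (by positivity), ← Real.exp_nat_mul]
  simp only [Pi.add_apply, inner_smul_right]
  rcases abs_cases (inner ℝ x t : ℝ) with h | h
  · rw [h.1]
    have := Real.exp_pos (-2 * inner ℝ x t)
    push_cast
    linarith
  · rw [h.1]
    have := Real.exp_pos (2 * inner ℝ x t)
    push_cast
    rw [show (2 : ℝ) * -inner ℝ x t = -2 * inner ℝ x t by ring]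
    linarith

/-- A function in `L_2(γ)` orthogonal to all Hermite polynomials has a vanishing
Fourier transform. -/
theorem integral_smul_exp_inner_eq_zero {f : L2Gaussian d} (hf : ∀ k, hermiteCoeff f k = 0)
    (t : EuclideanSpace ℝ (Fin d)) :
    ∫ x, f x • Complex.exp (inner ℝ x t * Complex.I) ∂gaussianMeasure d = 0 := by
  have hspan : ∀ q ∈ Submodule.span ℝ (Set.range (multiHermite (d := d))),
      Integrable (fun x => f x * q x) (gaussianMeasure d) ∧
        ∫ x, f x * q x ∂gaussianMeasure d = 0 := by
    intro q hq
    induction hq using Submodule.span_induction with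
    | mem q hq =>
      obtain ⟨k, rfl⟩ := hq
      exact ⟨integrable_mul_multiHermite f k, hf k⟩
    | zero => simp
    | add p q _ _ hp hq =>
      simp only [Pi.add_apply, mul_add]
      exact ⟨hp.1.add hq.1, by rw [integral_add hp.1 hq.1, hp.2, hq.2, add_zero]⟩
    | smul c q _ hq =>
      simp only [Pi.smul_apply, smul_eq_mul, mul_left_comm _ c]
      exact ⟨hq.1.const_mul c, by rw [integral_const_mul, hq.2, mul_zero]⟩
  -- The exponential is integrated term by term; the dominating sum |f| e^{|⟨x,t⟩|} is integrable as
  -- a product of two L_2 functions.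
  have hsum := hasSum_integral_of_dominated_convergence (μ := gaussianMeasure d)
    (F := fun (n : ℕ) x => f x • (((inner ℝ x t * Complex.I) ^ n) / (n ! : ℂ)))
    (f := fun x => f x • Complex.exp (inner ℝ x t * Complex.I))
    (fun (n : ℕ) x => |f x| * (|inner ℝ x t| ^ n / (n ! : ℝ))) ?_ ?_ ?_ ?_ ?_
  · refine hsum.unique ?_
    have : ∀ n : ℕ, ∫ x, f x • (((inner ℝ x t * Complex.I) ^ n) / (n ! : ℂ)) ∂gaussianMeasure d
        = 0 := by
      intro n
      have e : ∀ x, f x • (((inner ℝ x t * Complex.I) ^ n) / (n ! : ℂ)) =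
          ((f x * inner ℝ x t ^ n : ℝ) : ℂ) * (Complex.I ^ n / (n ! : ℂ)) := by
        intro x
        rw [Complex.real_smul]
        push_cast
        ring
      simp_rw [e]
      rw [integral_mul_const, integral_complex_ofReal,
        (hspan _ (inner_pow_mem_span_multiHermite t n)).2]
      simp
    simp_rw [this]
    exact hasSum_zero
  · intro n
    have h1 := (Lp.aestronglyMeasurable f)
    have h2 : Continuous fun x : EuclideanSpace ℝ (Fin d) =>
      ((inner ℝ x t * Complex.I) ^ n) / (n ! : ℂ) := by fun_prop
    exact h1.smul h2.aestronglyMeasurable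
  · intro n
    refine ae_of_all _ fun x => ?_
    simp
  · refine ae_of_all _ fun x => ?_
    exact (Real.summable_pow_div_factorial _).mul_left _
  · have e : ∀ x, ∑' n : ℕ, |f x| * (|inner ℝ x t| ^ n / (n ! : ℝ)) =
        |f x| * Real.exp |inner ℝ x t| := by
      intro x
      rw [tsum_mul_left, Real.exp_eq_exp_ℝ, NormedSpace.exp_eq_tsum_div]
    simp_rw [e]
    exact (Lp.memLp f).abs.integrable_mul (memLp_exp_abs_inner t)
  · refine ae_of_all _ fun x => ?_
    refine HasSum.const_smul (f x) ?_
    rw [Complex.exp_eq_exp_ℂ]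
    exact NormedSpace.expSeries_div_hasSum_exp _

/-- Uniqueness of characteristic functions concerns finite positive measures, so it is applied to
f⁺γ and f⁻γ. The vanishing Fourier transform of fγ makes them equal, and f⁺ = f⁻ forces f = 0. -/
theorem eq_zero_of_hermiteCoeff_eq_zero {f : L2Gaussian d} (hf : ∀ k, hermiteCoeff f k = 0) :
    f = 0 := by
  have hi : Integrable f (gaussianMeasure d) := (Lp.memLp f).integrable (by norm_num)
  have hm : Measurable f := (Lp.stronglyMeasurable f).measurable
  have hfin : ∀ g : EuclideanSpace ℝ (Fin d) → ℝ, Integrable g (gaussianMeasure d) →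
      IsFiniteMeasure ((gaussianMeasure d).withDensity fun x => ENNReal.ofReal (g x)) :=
    fun g hg => isFiniteMeasure_withDensity_ofReal hg.2
  have := hfin _ hi
  have : IsFiniteMeasure ((gaussianMeasure d).withDensity fun x => ENNReal.ofReal (-f x)) :=
    hfin _ hi.neg
  have hchar : ∀ g : EuclideanSpace ℝ (Fin d) → ℝ, Measurable g → ∀ t,
      charFun ((gaussianMeasure d).withDensity fun x => ENNReal.ofReal (g x)) t =
        ∫ x, max (g x) 0 • Complex.exp (inner ℝ x t * Complex.I) ∂gaussianMeasure d := by
    intro g hg t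
    rw [charFun_apply, integral_withDensity_eq_integral_toReal_smul hg.ennreal_ofReal
      (ae_of_all _ fun x => by simp)]
    simp [ENNReal.toReal_ofReal']
  have hexp : ∀ g : EuclideanSpace ℝ (Fin d) → ℝ, Integrable g (gaussianMeasure d) → ∀ t,
      Integrable (fun x => g x • Complex.exp (inner ℝ x t * Complex.I)) (gaussianMeasure d) := by
    intro g hg t
    refine hg.norm.mono' (hg.1.smul (Continuous.aestronglyMeasurable (by fun_prop)))
      (ae_of_all _ fun x => ?_)
    rw [norm_smul, Complex.norm_exp_ofReal_mul_I, mul_one]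
  have heq : ((gaussianMeasure d).withDensity fun x => ENNReal.ofReal (f x)) =
      (gaussianMeasure d).withDensity fun x => ENNReal.ofReal (-f x) := by
    refine Measure.ext_of_charFun (funext fun t => ?_)
    rw [hchar _ hm, hchar (fun x => -f x) hm.neg, ← sub_eq_zero, ← integral_sub (hexp _ hi.pos_part t)
      (hexp (fun x => max (-f x) 0) (hi.neg.pos_part) t), ← integral_smul_exp_inner_eq_zero hf t]
    refine integral_congr_ae (ae_of_all _ fun x => ?_)
    simp only [← sub_smul]
    congr 1
    rcases le_total 0 (f x) with h | h <;> simp [h]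
  rw [withDensity_eq_iff hm.ennreal_ofReal.aemeasurable
    (g := fun x => ENNReal.ofReal (-f x)) hm.neg.ennreal_ofReal.aemeasurable
    hi.lintegral_lt_top.ne] at heq
  rw [Lp.eq_zero_iff_ae_eq_zero]
  filter_upwards [heq] with x hx
  rcases lt_trichotomy (f x) 0 with h | h | h
  · simp [ENNReal.ofReal_of_nonpos h.le] at hx
    linarith
  · exact h
  · simp [ENNReal.ofReal_of_nonpos (neg_nonpos.2 h.le)] at hx
    linarith

/-- The Hermite polynomials form a Hilbert basis of `L_2(γ)`. -/
noncomputable def hermiteBasis (d : ℕ) : HilbertBasis (Fin d → ℕ) ℝ (L2Gaussian d) :=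
  HilbertBasis.mkOfOrthogonalEqBot orthonormal_hermiteVec <| by
    rw [Submodule.eq_bot_iff]
    intro f hf
    refine eq_zero_of_hermiteCoeff_eq_zero fun k => ?_
    rw [hermiteCoeff_eq_inner]
    exact (Submodule.mem_orthogonal _ _).1 hf _ (Submodule.subset_span ⟨k, rfl⟩)

theorem hermiteBasis_apply (k : Fin d → ℕ) : hermiteBasis d k = hermiteVec k := by
  simp [hermiteBasis]

theorem hasSum_hermiteCoeff_sq (f : L2Gaussian d) :
    HasSum (fun k => hermiteCoeff f k ^ 2) (‖f‖ ^ 2) := by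
  have := (hermiteBasis d).hasSum_inner_mul_inner f f
  rw [real_inner_self_eq_norm_sq] at this
  refine this.congr_fun fun k => ?_
  rw [hermiteBasis_apply, hermiteCoeff_eq_inner, real_inner_comm, sq]

theorem enorm_sq_eq_tsum (f : L2Gaussian d) :
    ‖f‖ₑ ^ 2 = ∑' k, ENNReal.ofReal (hermiteCoeff f k ^ 2) := by
  rw [← ENNReal.ofReal_tsum_of_nonneg (fun k => sq_nonneg _) (hasSum_hermiteCoeff_sq f).summable,
    (hasSum_hermiteCoeff_sq f).tsum_eq, ← ofReal_norm, ENNReal.ofReal_pow (norm_nonneg _)]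

end GaussianSobolev

namespace GaussianSobolev

/-! ### Partial derivatives of smooth functions -/

open ProbabilityTheory

variable {d : ℕ}

theorem contDiff_partialDeriv {u : EuclideanSpace ℝ (Fin d) → ℝ} (hu : ContDiff ℝ ∞ u)
    (i : Fin d) : ContDiff ℝ ∞ (partialDeriv i u) :=
  (hu.fderiv_right (m := ∞) (by simp)).clm_apply contDiff_const

theorem hasCompactSupport_partialDeriv {u : EuclideanSpace ℝ (Fin d) → ℝ}
    (hu : HasCompactSupport u) (i : Fin d) : HasCompactSupport (partialDeriv i u) :=
  hu.fderiv_apply ℝ _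

theorem partialDeriv_comm {u : EuclideanSpace ℝ (Fin d) → ℝ} (hu : ContDiff ℝ ∞ u)
    (i j : Fin d) : partialDeriv i (partialDeriv j u) = partialDeriv j (partialDeriv i u) := by
  have hd : Differentiable ℝ (fderiv ℝ u) :=
    (hu.fderiv_right (m := ∞) (by simp)).differentiable (by simp)
  ext x
  have hs : IsSymmSndFDerivAt ℝ u x := hu.contDiffAt.isSymmSndFDerivAt (by
    rw [minSmoothness_of_isRCLikeNormedField]; exact WithTop.coe_le_coe.2 (le_top : (2 : ℕ∞) ≤ ⊤))
  have h : ∀ v w : EuclideanSpace ℝ (Fin d),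
      fderiv ℝ (fun y => fderiv ℝ u y v) x w = fderiv ℝ (fderiv ℝ u) x w v := by
    intro v w
    rw [fderiv_clm_apply hd.differentiableAt (differentiableAt_const v)]
    simp
  change fderiv ℝ (fun y => fderiv ℝ u y _) x _ = fderiv ℝ (fun y => fderiv ℝ u y _) x _
  rw [h, h]
  exact hs.eq _ _

theorem contDiff_iterate_partialDeriv {u : EuclideanSpace ℝ (Fin d) → ℝ} (hu : ContDiff ℝ ∞ u)
    (i : Fin d) (n : ℕ) : ContDiff ℝ ∞ ((partialDeriv i)^[n] u) := by
  induction n with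
  | zero => exact hu
  | succ n ih =>
    rw [Function.iterate_succ_apply']
    exact contDiff_partialDeriv ih i

theorem partialDeriv_iterate_comm {u : EuclideanSpace ℝ (Fin d) → ℝ} (hu : ContDiff ℝ ∞ u)
    (i j : Fin d) (n : ℕ) :
    partialDeriv i ((partialDeriv j)^[n] u) = (partialDeriv j)^[n] (partialDeriv i u) := by
  induction n with
  | zero => rfl
  | succ n ih =>
    rw [Function.iterate_succ_apply', Function.iterate_succ_apply', ← ih,
      partialDeriv_comm (contDiff_iterate_partialDeriv hu j n)]

theorem contDiff_foldr_partialDeriv (α : Fin d → ℕ) {u : EuclideanSpace ℝ (Fin d) → ℝ}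
    (hu : ContDiff ℝ ∞ u) (l : List (Fin d)) :
    ContDiff ℝ ∞ (l.foldr (fun i ψ => (partialDeriv i)^[α i] ψ) u) := by
  induction l with
  | nil => exact hu
  | cons j l ih => exact contDiff_iterate_partialDeriv ih j _

theorem foldr_partialDeriv_comm (α : Fin d → ℕ) {u : EuclideanSpace ℝ (Fin d) → ℝ}
    (hu : ContDiff ℝ ∞ u) (i : Fin d) (l : List (Fin d)) :
    partialDeriv i (l.foldr (fun i ψ => (partialDeriv i)^[α i] ψ) u) =
      l.foldr (fun i ψ => (partialDeriv i)^[α i] ψ) (partialDeriv i u) := by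
  induction l with
  | nil => rfl
  | cons j l ih =>
    rw [List.foldr_cons, List.foldr_cons,
      partialDeriv_iterate_comm (contDiff_foldr_partialDeriv α hu l), ih]

/-- Since partial derivatives of smooth functions commute, the extra ∂_i can be moved to the
innermost place. The index i occurs exactly once in `List.finRange d`, so exactly one exponent
changes. -/
theorem multiDeriv_add_single (α : Fin d → ℕ) (i : Fin d) {u : EuclideanSpace ℝ (Fin d) → ℝ}
    (hu : ContDiff ℝ ∞ u) :
    multiDeriv (α + Pi.single i 1) u = multiDeriv α (partialDeriv i u) := by
  have hnot : ∀ (l : List (Fin d)) (v : EuclideanSpace ℝ (Fin d) → ℝ), i ∉ l →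
      l.foldr (fun j ψ => (partialDeriv j)^[(α + Pi.single i 1 : Fin d → ℕ) j] ψ) v =
        l.foldr (fun j ψ => (partialDeriv j)^[α j] ψ) v := by
    intro l v hl
    refine List.foldr_ext _ _ _ fun j hj ψ => ?_
    have : j ≠ i := fun h => hl (h ▸ hj)
    simp [this]
  have hmem : ∀ l : List (Fin d), l.Nodup → i ∈ l →
      l.foldr (fun j ψ => (partialDeriv j)^[(α + Pi.single i 1 : Fin d → ℕ) j] ψ) u =
        l.foldr (fun j ψ => (partialDeriv j)^[α j] ψ) (partialDeriv i u) := by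
    intro l
    induction l with
    | nil => simp
    | cons j l ih =>
      intro hn hi
      rw [List.nodup_cons] at hn
      rw [List.foldr_cons, List.foldr_cons]
      by_cases h : j = i
      · subst h
        rw [hnot l u hn.1, ← foldr_partialDeriv_comm α hu]
        simp
      · have hi' : i ∈ l := by
          rcases List.mem_cons.1 hi with h' | h'
          · exact absurd h'.symm h
          · exact h'
        rw [ih hn.2 hi']
        simp [h]
  exact hmem _ (List.nodup_finRange d) (List.mem_finRange i)

theorem multiDeriv_zero (u : EuclideanSpace ℝ (Fin d) → ℝ) : multiDeriv 0 u = u := by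
  have : ∀ l : List (Fin d),
      l.foldr (fun i ψ => (partialDeriv i)^[(0 : Fin d → ℕ) i] ψ) u = u := by
    intro l
    induction l with
    | nil => rfl
    | cons j l ih => rw [List.foldr_cons, ih]; rfl
  exact this _

theorem contDiff_multiDeriv (α : Fin d → ℕ) {u : EuclideanSpace ℝ (Fin d) → ℝ}
    (hu : ContDiff ℝ ∞ u) : ContDiff ℝ ∞ (multiDeriv α u) :=
  contDiff_foldr_partialDeriv α hu _

/-- Allows statements about D^α to be proved by one first-order integration by parts at a time. -/
theorem multiIndex_induction {P : (Fin d → ℕ) → Prop} (h0 : P 0)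
    (hs : ∀ β i, P β → P (β + Pi.single i 1)) (α : Fin d → ℕ) : P α := by
  induction hn : ∑ i, α i generalizing α with
  | zero =>
    have : α = 0 := funext fun i => (Finset.sum_eq_zero_iff.1 hn) i (Finset.mem_univ i)
    rwa [this]
  | succ n ih =>
    obtain ⟨i, -, hi⟩ := Finset.exists_ne_zero_of_sum_ne_zero (s := Finset.univ) (f := α) (by omega)
    have hα : α - Pi.single i 1 + Pi.single i 1 = α := by
      ext j
      by_cases h : j = i
      · subst h
        simp
        omega
      · simp [h]
    have hsum : ∑ j, (α - Pi.single i 1 : Fin d → ℕ) j + 1 = n + 1 := by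
      rw [← hn, ← hα]
      simp [Finset.sum_add_distrib]
    rw [← hα]
    exact hs _ i (ih _ (by omega))

theorem sum_add_single (α : Fin d → ℕ) (i : Fin d) :
    ∑ j, (α + Pi.single i 1 : Fin d → ℕ) j = ∑ j, α j + 1 := by
  simp [Finset.sum_add_distrib]

theorem hasCompactSupport_multiDeriv (α : Fin d → ℕ) {u : EuclideanSpace ℝ (Fin d) → ℝ}
    (hu : ContDiff ℝ ∞ u) (hc : HasCompactSupport u) : HasCompactSupport (multiDeriv α u) := by
  induction α using multiIndex_induction generalizing u with
  | h0 => rwa [multiDeriv_zero]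
  | hs β i ih =>
    rw [multiDeriv_add_single β i hu]
    exact ih (contDiff_partialDeriv hu i) (hasCompactSupport_partialDeriv hc i)

theorem partialDeriv_mul {u v : EuclideanSpace ℝ (Fin d) → ℝ} (hu : Differentiable ℝ u)
    (hv : Differentiable ℝ v) (i : Fin d) (x : EuclideanSpace ℝ (Fin d)) :
    partialDeriv i (fun x => u x * v x) x =
      u x * partialDeriv i v x + partialDeriv i u x * v x := by
  simp only [partialDeriv]
  rw [fderiv_fun_mul hu.differentiableAt hv.differentiableAt]
  simp
  ring

/-- Along the i-th coordinate line only the i-th factor moves, so its derivative alone is required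
once the product is known to be differentiable. -/
theorem partialDeriv_prod {g : Fin d → ℝ → ℝ} {x : EuclideanSpace ℝ (Fin d)} {i : Fin d} {c : ℝ}
    (h : HasDerivAt (g i) c (x i))
    (hd : DifferentiableAt ℝ (fun x : EuclideanSpace ℝ (Fin d) => ∏ j, g j (x j)) x) :
    partialDeriv i (fun x => ∏ j, g j (x j)) x =
      c * ∏ j ∈ Finset.univ.erase i, g j (x j) := by
  rw [partialDeriv, ← hd.lineDeriv_eq_fderiv, lineDeriv]
  have e : ∀ t : ℝ, ∏ j, g j ((x + t • EuclideanSpace.single i (1 : ℝ)) j) =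
      g i (x i + t) * ∏ j ∈ Finset.univ.erase i, g j (x j) := by
    intro t
    rw [← Finset.mul_prod_erase _ _ (Finset.mem_univ i)]
    congr 1
    · simp
    · refine Finset.prod_congr rfl fun j hj => ?_
      simp [Finset.ne_of_mem_erase hj]
  simp_rw [e]
  have h2 : HasDerivAt (fun t => g i (x i + t)) c 0 := by
    have := HasDerivAt.comp_const_add (x i) 0 (f := g i) (f' := c) (by simpa using h)
    exact this
  exact (h2.mul_const _).deriv

theorem partialDeriv_multiHermite (k : Fin d → ℕ) (i : Fin d) :
    partialDeriv i (multiHermite k) =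
      fun x => √(k i : ℝ) * multiHermite (k - Pi.single i 1) x := by
  ext x
  have h := partialDeriv_prod (g := fun j => hermiteFun (k j)) (hasDerivAt_hermiteFun (k i) (x i))
    ((contDiff_multiHermite k (n := 1)).differentiable (by simp)).differentiableAt
  rw [multiHermite_eq_mul_prod_erase (k := k) (l := k - Pi.single i 1) (i := i)
    fun j hj => by simp [hj]]
  simp only [Pi.sub_apply, Pi.single_eq_same, ← mul_assoc]
  exact h

theorem partialDeriv_gaussianDensity (i : Fin d) :
    partialDeriv i (gaussianDensity d) = fun x => -x i * gaussianDensity d x := by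
  ext x
  have e : gaussianDensity d = fun x : EuclideanSpace ℝ (Fin d) =>
    ∏ j, gaussianPDFReal 0 1 (x j) := funext gaussianDensity_eq_prod
  have hd := ((contDiff_gaussianDensity (d := d) (n := 1)).differentiable
    (by simp)).differentiableAt (x := x)
  rw [e] at hd ⊢
  rw [partialDeriv_prod (g := fun _ => gaussianPDFReal 0 1)
    (hasDerivAt_gaussianPDFReal 0 one_ne_zero (x i)) hd]
  simp only
  rw [← Finset.mul_prod_erase Finset.univ _ (Finset.mem_univ i)]
  simp [mul_assoc]

theorem partialDeriv_multiHermite_mul_gaussianDensity (k : Fin d → ℕ) (i : Fin d)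
    (x : EuclideanSpace ℝ (Fin d)) :
    partialDeriv i (fun x => multiHermite k x * gaussianDensity d x) x =
      -(√((k i : ℝ) + 1) * (multiHermite (k + Pi.single i 1) x * gaussianDensity d x)) := by
  rw [partialDeriv_mul ((contDiff_multiHermite k (n := 1)).differentiable (by simp))
    ((contDiff_gaussianDensity (n := 1)).differentiable (by simp)),
    partialDeriv_multiHermite, partialDeriv_gaussianDensity]
  have := coord_mul_multiHermite k i x
  simp only
  linear_combination (-gaussianDensity d x) * this

/-! ### Weak derivatives and Hermite coefficients -/

theorem locallyIntegrable_coeFn (f : L2Gaussian d) : LocallyIntegrable f volume := by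
  have hi : Integrable (fun x => f x * gaussianDensity d x) :=
    integrable_gaussianMeasure_iff.1 ((Lp.memLp f).integrable (by norm_num))
  rw [locallyIntegrable_iff]
  intro K hK
  have hc : ContinuousOn (fun x => (gaussianDensity d x)⁻¹) K :=
    (continuous_gaussianDensity.inv₀ fun x => (gaussianDensity_pos x).ne').continuousOn
  refine (hi.integrableOn.mul_continuousOn hc hK).congr (ae_of_all _ fun x => ?_)
  simp only
  rw [mul_assoc, mul_inv_cancel₀ (gaussianDensity_pos x).ne', mul_one]

theorem integrable_coeFn_mul (f : L2Gaussian d) {u : EuclideanSpace ℝ (Fin d) → ℝ}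
    (hu : Continuous u) (hc : HasCompactSupport u) : Integrable (fun x => f x * u x) := by
  simpa only [smul_eq_mul, mul_comm] using
    (locallyIntegrable_coeFn f).integrable_smul_left_of_hasCompactSupport hu hc

/-- The fundamental lemma of the calculus of variations, valid because elements of L_2(γ) are
locally Lebesgue integrable. -/
theorem eq_of_hasWeakDeriv_zero {f g : L2Gaussian d} (h : HasWeakDeriv 0 f g) : g = f := by
  have hae : ∀ᵐ x, g x = f x := by
    refine ae_eq_of_integral_contDiff_smul_eq (locallyIntegrable_coeFn g)
      (locallyIntegrable_coeFn f) fun u hu hc => ?_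
    have := h u hu hc
    simp only [multiDeriv_zero, Pi.zero_apply, Finset.sum_const_zero, pow_zero, one_mul] at this
    simp only [smul_eq_mul, mul_comm (u _), this]
  exact Lp.ext ((withDensity_absolutelyContinuous _ _).ae_le hae)

/-- Taking ∂_i u as the test function for D^α f exhibits h as the weak ∂_i of g. -/
theorem HasWeakDeriv.integral_mul_partialDeriv {α : Fin d → ℕ} {i : Fin d} {f g h : L2Gaussian d}
    (hg : HasWeakDeriv α f g) (hh : HasWeakDeriv (α + Pi.single i 1) f h)
    {u : EuclideanSpace ℝ (Fin d) → ℝ} (hu : ContDiff ℝ ∞ u) (hc : HasCompactSupport u) :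
    ∫ x, g x * partialDeriv i u x = -∫ x, h x * u x := by
  have h1 := hg _ (contDiff_partialDeriv hu i) (hasCompactSupport_partialDeriv hc i)
  have h2 := hh u hu hc
  rw [multiDeriv_add_single α i hu, h1, sum_add_single, pow_succ] at h2
  have h3 : ((-1 : ℝ) ^ ∑ j, α j) ≠ 0 := pow_ne_zero _ (by norm_num)
  apply mul_left_cancel₀ h3
  rw [h2]
  ring

/-- Smooth compactly supported cutoff functions converging to one, with uniformly bounded
derivatives that converge to zero. -/
theorem exists_cutoff (d : ℕ) : ∃ χ : ℕ → EuclideanSpace ℝ (Fin d) → ℝ,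
    (∀ n, ContDiff ℝ ∞ (χ n)) ∧ (∀ n, HasCompactSupport (χ n)) ∧
    (∀ x, Tendsto (fun n => χ n x) atTop (𝓝 1)) ∧ (∀ n x, |χ n x| ≤ 1) ∧
    ∀ i, ∃ C, ∀ n x, |partialDeriv i (χ n) x| ≤ ((n : ℝ) + 1)⁻¹ * C := by
  -- A single bump is dilated by n+1, which multiplies its first derivatives by 1/(n+1).
  let b : ContDiffBump (0 : EuclideanSpace ℝ (Fin d)) := ⟨1, 2, by norm_num, by norm_num⟩
  have hpos : ∀ n : ℕ, ((n : ℝ) + 1)⁻¹ ≠ 0 := fun n => by positivity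
  refine ⟨fun n x => b (((n : ℝ) + 1)⁻¹ • x), fun n => ?_, fun n => ?_, fun x => ?_,
    fun n x => ?_, fun i => ?_⟩
  · exact b.contDiff.comp (contDiff_id.const_smul _)
  · exact b.hasCompactSupport.comp_smul (hpos n)
  · have h1 : Tendsto (fun n : ℕ => ((n : ℝ) + 1)⁻¹ • x) atTop (𝓝 0) := by
      have := (tendsto_one_div_add_atTop_nhds_zero_nat (𝕜 := ℝ)).smul_const x
      simpa using this
    have h2 := (b.continuous.tendsto 0).comp h1
    rwa [b.one_of_mem_closedBall (Metric.mem_closedBall_self b.rIn_pos.le)] at h2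
  · rw [abs_of_nonneg b.nonneg]
    exact b.le_one
  · obtain ⟨C, hC⟩ := (hasCompactSupport_partialDeriv b.hasCompactSupport i).exists_bound_of_continuous
      (contDiff_partialDeriv b.contDiff i).continuous
    refine ⟨C, fun n x => ?_⟩
    have : partialDeriv i (fun x => b (((n : ℝ) + 1)⁻¹ • x)) x =
        ((n : ℝ) + 1)⁻¹ * partialDeriv i b (((n : ℝ) + 1)⁻¹ • x) := by
      simp only [partialDeriv]
      rw [fderiv_comp_smul]
      simp
    rw [this, abs_mul, abs_of_nonneg (by positivity)]
    exact mul_le_mul_of_nonneg_left (hC _) (by positivity)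

/-- Integration by parts extends from compactly supported to general smooth functions, provided
the products are integrable. -/
theorem integral_mul_partialDeriv_of_forall_compactSupport
    {g h v : EuclideanSpace ℝ (Fin d) → ℝ} {i : Fin d}
    (H : ∀ u : EuclideanSpace ℝ (Fin d) → ℝ, ContDiff ℝ ∞ u → HasCompactSupport u →
      ∫ x, g x * partialDeriv i u x = -∫ x, h x * u x)
    (hv : ContDiff ℝ ∞ v) (h1 : Integrable fun x => g x * v x)
    (h2 : Integrable fun x => g x * partialDeriv i v x) (h3 : Integrable fun x => h x * v x) :
    ∫ x, g x * partialDeriv i v x = -∫ x, h x * v x := by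
  obtain ⟨χ, χs, χc, χt, χb, χd⟩ := exists_cutoff d
  obtain ⟨C, hC⟩ := χd i
  have hH := fun n => H (fun x => χ n x * v x) ((χs n).mul hv) ((χc n).mul_right)
  -- By the Leibniz rule the first summand tends to the wanted integrand; the second contains
  -- ∂_iχ_n, which tends to zero and is bounded by C.
  have e : ∀ n x, g x * partialDeriv i (fun x => χ n x * v x) x =
      χ n x * (g x * partialDeriv i v x) + partialDeriv i (χ n) x * (g x * v x) := by
    intro n x
    rw [partialDeriv_mul ((χs n).differentiable (by simp)) (hv.differentiable (by simp))]
    ring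
  have hC0 : 0 ≤ C := by
    have := (abs_nonneg _).trans (hC 0 0)
    simpa using this
  have t1 : Tendsto (fun n => ∫ x, g x * partialDeriv i (fun x => χ n x * v x) x) atTop
      (𝓝 (∫ x, g x * partialDeriv i v x)) := by
    simp_rw [e]
    refine tendsto_integral_of_dominated_convergence
      (fun x => |g x * partialDeriv i v x| + C * |g x * v x|) (fun n => ?_)
      (h2.abs.add (h1.abs.const_mul C)) (fun n => ae_of_all _ fun x => ?_)
      (ae_of_all _ fun x => ?_)
    · exact ((χs n).continuous.aestronglyMeasurable.mul h2.1).add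
        ((contDiff_partialDeriv (χs n) i).continuous.aestronglyMeasurable.mul h1.1)
    · refine (norm_add_le _ _).trans (add_le_add ?_ ?_)
      · rw [Real.norm_eq_abs, abs_mul]
        exact mul_le_of_le_one_left (abs_nonneg _) (χb n x)
      · rw [Real.norm_eq_abs, abs_mul]
        refine mul_le_mul_of_nonneg_right ((hC n x).trans ?_) (abs_nonneg _)
        refine mul_le_of_le_one_left hC0 (inv_le_one_of_one_le₀ ?_)
        linarith [(Nat.cast_nonneg n : (0 : ℝ) ≤ n)]
    · have hz : Tendsto (fun n => partialDeriv i (χ n) x) atTop (𝓝 0) := by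
        refine squeeze_zero_norm (a := fun n : ℕ => ((n : ℝ) + 1)⁻¹ * C) (fun n => hC n x) ?_
        have := (tendsto_one_div_add_atTop_nhds_zero_nat (𝕜 := ℝ)).mul_const C
        simpa using this
      have := ((χt x).mul_const (g x * partialDeriv i v x)).add (hz.mul_const (g x * v x))
      simpa using this
  have t2 : Tendsto (fun n => ∫ x, h x * (χ n x * v x)) atTop (𝓝 (∫ x, h x * v x)) := by
    refine tendsto_integral_of_dominated_convergence (fun x => |h x * v x|) (fun n => ?_)
      h3.abs (fun n => ae_of_all _ fun x => ?_) (ae_of_all _ fun x => ?_)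
    · simp only [mul_left_comm (h _)]
      exact (χs n).continuous.aestronglyMeasurable.mul h3.1
    · rw [mul_left_comm, Real.norm_eq_abs, abs_mul]
      exact mul_le_of_le_one_left (abs_nonneg _) (χb n x)
    · have := (χt x).mul_const (h x * v x)
      simp_rw [mul_left_comm (h x)]
      simpa using this
  simp_rw [hH] at t1
  exact tendsto_nhds_unique t1 t2.neg

theorem hermiteCoeff_eq_integral (f : L2Gaussian d) (k : Fin d → ℕ) :
    hermiteCoeff f k = ∫ x, f x * (multiHermite k x * gaussianDensity d x) := by
  rw [hermiteCoeff, integral_gaussianMeasure]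
  refine integral_congr_ae (ae_of_all _ fun x => ?_)
  simp only [smul_eq_mul]
  ring

theorem integrable_mul_multiHermite_mul_gaussianDensity (f : L2Gaussian d) (k : Fin d → ℕ) :
    Integrable fun x => f x * (multiHermite k x * gaussianDensity d x) := by
  simpa only [mul_assoc] using integrable_gaussianMeasure_iff.1 (integrable_mul_multiHermite f k)

/-- Test with H_k times the Gaussian density, whose ∂_i is -√(k_i+1) H_{k+e_i} times the density.
This function lacks compact support, hence the cutoff argument above. -/
theorem HasWeakDeriv.hermiteCoeff_add_single {α : Fin d → ℕ} {i : Fin d} {f g h : L2Gaussian d}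
    (hg : HasWeakDeriv α f g) (hh : HasWeakDeriv (α + Pi.single i 1) f h) (k : Fin d → ℕ) :
    hermiteCoeff h k = √((k i : ℝ) + 1) * hermiteCoeff g (k + Pi.single i 1) := by
  have e : ∀ x, g x * partialDeriv i (fun x => multiHermite k x * gaussianDensity d x) x =
      -√((k i : ℝ) + 1) * (g x * (multiHermite (k + Pi.single i 1) x * gaussianDensity d x)) := by
    intro x
    rw [partialDeriv_multiHermite_mul_gaussianDensity]
    ring
  have := integral_mul_partialDeriv_of_forall_compactSupport (g := g) (h := h) (i := i)
    (v := fun x => multiHermite k x * gaussianDensity d x)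
    (fun u hu hc => hg.integral_mul_partialDeriv hh hu hc)
    ((contDiff_multiHermite k).mul contDiff_gaussianDensity)
    (integrable_mul_multiHermite_mul_gaussianDensity g k)
    (by
      simp_rw [e]
      exact (integrable_mul_multiHermite_mul_gaussianDensity g _).const_mul _)
    (integrable_mul_multiHermite_mul_gaussianDensity h k)
  simp_rw [e] at this
  rw [integral_const_mul, ← hermiteCoeff_eq_integral, ← hermiteCoeff_eq_integral] at this
  linarith

/-- The product `k! / (k - α)!` of falling factorials. -/
def descFactorialProd (k α : Fin d → ℕ) : ℕ :=
  ∏ i, (k i).descFactorial (α i)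

theorem descFactorialProd_add_single (k α : Fin d → ℕ) (i : Fin d) :
    descFactorialProd k (α + Pi.single i 1) = (k i - α i) * descFactorialProd k α := by
  simp only [descFactorialProd]
  rw [← Finset.mul_prod_erase _ _ (Finset.mem_univ i),
    ← Finset.mul_prod_erase Finset.univ (fun j => (k j).descFactorial (α j))
      (Finset.mem_univ i), ← mul_assoc]
  congr 1
  · simp [Nat.descFactorial_succ]
  · exact Finset.prod_congr rfl fun j hj => by simp [Finset.ne_of_mem_erase hj]

/-- The multi-index grows one unit at a time, so all intermediate weak derivatives must exist in
L_2(γ); membership of f in the Sobolev space provides them. -/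
theorem hermiteCoeff_of_hasWeakDeriv {m : ℕ} {f : L2Gaussian d} (hf : f ∈ intSobolevSpace d m)
    (α : Fin d → ℕ) (hα : ∑ i, α i ≤ m) {g : L2Gaussian d} (hg : HasWeakDeriv α f g)
    (k : Fin d → ℕ) :
    hermiteCoeff g k = √(descFactorialProd (k + α) α : ℝ) * hermiteCoeff f (k + α) := by
  induction α using multiIndex_induction generalizing g k with
  | h0 => simp [eq_of_hasWeakDeriv_zero hg, descFactorialProd]
  | hs β i ih =>
    rw [sum_add_single] at hα
    obtain ⟨g', hg'⟩ := hf β (by omega)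
    rw [hg'.hermiteCoeff_add_single hg, ih (by omega) hg', descFactorialProd_add_single,
      ← mul_assoc, show k + Pi.single i 1 + β = k + (β + Pi.single i 1) by abel]
    congr 1
    rw [← Real.sqrt_mul (by positivity)]
    congr 1
    -- The coefficient of the single differentiation step is the square root of precisely the next
    -- factor of the falling factorial.
    have : (k + (β + Pi.single i 1) : Fin d → ℕ) i - β i = k i + 1 := by simp; omega
    rw [this]
    push_cast
    ring

theorem weakDeriv_spec {m : ℕ} {f : L2Gaussian d} (hf : f ∈ intSobolevSpace d m)
    {α : Fin d → ℕ} (hα : ∑ i, α i ≤ m) : HasWeakDeriv α f (weakDeriv α f) := by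
  rw [weakDeriv, dif_pos (hf α hα)]
  exact (hf α hα).choose_spec

theorem hermiteCoeff_weakDeriv {m : ℕ} {f : L2Gaussian d} (hf : f ∈ intSobolevSpace d m)
    {α : Fin d → ℕ} (hα : ∑ i, α i ≤ m) (k : Fin d → ℕ) :
    hermiteCoeff (weakDeriv α f) k =
      √(descFactorialProd (k + α) α : ℝ) * hermiteCoeff f (k + α) :=
  hermiteCoeff_of_hasWeakDeriv hf α hα (weakDeriv_spec hf hα) k

/-- Where α ≤ k fails, the truncated `k - α` is meaningless, but the falling factorial then
vanishes, so no case distinction is needed. -/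
theorem integral_multiHermite_mul_multiDeriv (k α : Fin d → ℕ)
    {u : EuclideanSpace ℝ (Fin d) → ℝ} (hu : ContDiff ℝ ∞ u) (hc : HasCompactSupport u) :
    ∫ x, multiHermite k x * multiDeriv α u x = (-1) ^ (∑ i, α i) *
      (√(descFactorialProd k α : ℝ) * ∫ x, multiHermite (k - α) x * u x) := by
  induction α using multiIndex_induction generalizing u with
  | h0 => simp [multiDeriv_zero, descFactorialProd]
  | hs β i ih =>
    have hint : ∀ (w v : EuclideanSpace ℝ (Fin d) → ℝ), Continuous w → Continuous v →
        HasCompactSupport v → Integrable fun x => w x * v x := fun w v hw hv hvc =>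
      (hw.mul hv).integrable_of_hasCompactSupport hvc.mul_left
    have hs : ContDiff ℝ ∞ (multiHermite (k - β)) := contDiff_multiHermite _
    have hparts : ∫ x, multiHermite (k - β) x * partialDeriv i u x =
        -∫ x, partialDeriv i (multiHermite (k - β)) x * u x :=
      integral_mul_fderiv_eq_neg_fderiv_mul_of_integrable
        (hint _ _ (contDiff_partialDeriv hs i).continuous hu.continuous hc)
        (hint _ _ hs.continuous (contDiff_partialDeriv hu i).continuous
          (hasCompactSupport_partialDeriv hc i))
        (hint _ _ hs.continuous hu.continuous hc)
        (fun x _ => (hs.differentiable (by simp)).differentiableAt)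
        (fun x _ => (hu.differentiable (by simp)).differentiableAt)
    rw [multiDeriv_add_single β i hu, ih (contDiff_partialDeriv hu i)
      (hasCompactSupport_partialDeriv hc i), hparts, partialDeriv_multiHermite, sum_add_single,
      descFactorialProd_add_single, show k - (β + Pi.single i 1) = k - β - Pi.single i 1 from
        (tsub_tsub _ _ _).symm]
    simp_rw [mul_assoc]
    rw [integral_const_mul]
    push_cast
    rw [Real.sqrt_mul (by positivity), pow_succ]
    simp only [Pi.sub_apply]
    ring

theorem hasWeakDeriv_hermiteVec (k α : Fin d → ℕ) :
    HasWeakDeriv α (hermiteVec k) (√(descFactorialProd k α : ℝ) • hermiteVec (k - α)) := by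
  intro u hu hc
  have h1 : ∀ᵐ x, hermiteVec k x = multiHermite k x :=
    volume_absolutelyContinuous_gaussianMeasure.ae_le (coeFn_hermiteVec k)
  have h2 : ∀ᵐ x, (√(descFactorialProd k α : ℝ) • hermiteVec (k - α) : L2Gaussian d) x =
      √(descFactorialProd k α : ℝ) * multiHermite (k - α) x := by
    refine volume_absolutelyContinuous_gaussianMeasure.ae_le ?_
    filter_upwards [Lp.coeFn_smul (√(descFactorialProd k α : ℝ)) (hermiteVec (k - α)),
      coeFn_hermiteVec (k - α)] with x hx1 hx2
    rw [hx1, Pi.smul_apply, hx2, smul_eq_mul]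
  have e1 : ∫ x, hermiteVec k x * multiDeriv α u x = ∫ x, multiHermite k x * multiDeriv α u x :=
    integral_congr_ae (by filter_upwards [h1] with x hx; rw [hx])
  have e2 : ∫ x, (√(descFactorialProd k α : ℝ) • hermiteVec (k - α) : L2Gaussian d) x * u x =
      √(descFactorialProd k α : ℝ) * ∫ x, multiHermite (k - α) x * u x := by
    rw [← integral_const_mul]
    exact integral_congr_ae (by filter_upwards [h2] with x hx; rw [hx, mul_assoc])
  rw [e1, e2, integral_multiHermite_mul_multiDeriv k α hu hc]

theorem HasWeakDeriv.add {α : Fin d → ℕ} {f₁ f₂ g₁ g₂ : L2Gaussian d}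
    (h₁ : HasWeakDeriv α f₁ g₁) (h₂ : HasWeakDeriv α f₂ g₂) :
    HasWeakDeriv α (f₁ + f₂) (g₁ + g₂) := by
  intro u hu hc
  have key : ∀ (p q : L2Gaussian d) (w : EuclideanSpace ℝ (Fin d) → ℝ), Continuous w →
      HasCompactSupport w → ∫ x, (p + q) x * w x = (∫ x, p x * w x) + ∫ x, q x * w x := by
    intro p q w hw hwc
    rw [← integral_add (integrable_coeFn_mul p hw hwc) (integrable_coeFn_mul q hw hwc)]
    refine integral_congr_ae ?_
    filter_upwards [volume_absolutelyContinuous_gaussianMeasure.ae_le (Lp.coeFn_add p q)] with x hx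
    rw [hx, Pi.add_apply, add_mul]
  rw [key _ _ _ (contDiff_multiDeriv α hu).continuous (hasCompactSupport_multiDeriv α hu hc),
    key _ _ _ hu.continuous hc, h₁ u hu hc, h₂ u hu hc, mul_add]

theorem HasWeakDeriv.smul {α : Fin d → ℕ} {f g : L2Gaussian d} (c : ℝ)
    (h : HasWeakDeriv α f g) : HasWeakDeriv α (c • f) (c • g) := by
  intro u hu hc
  have key : ∀ (p : L2Gaussian d) (w : EuclideanSpace ℝ (Fin d) → ℝ),
      ∫ x, (c • p) x * w x = c * ∫ x, p x * w x := by
    intro p w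
    rw [← integral_const_mul]
    refine integral_congr_ae ?_
    filter_upwards [volume_absolutelyContinuous_gaussianMeasure.ae_le (Lp.coeFn_smul c p)] with x hx
    rw [hx, Pi.smul_apply, smul_eq_mul, mul_assoc]
  rw [key, key, h u hu hc, mul_left_comm]

/-- Linear combinations of Hermite polynomials belong to all integer Sobolev spaces. -/
theorem mem_intSobolevSpace_of_mem_span {f : L2Gaussian d}
    (hf : f ∈ Submodule.span ℝ (Set.range (hermiteVec (d := d)))) (m : ℕ) :
    f ∈ intSobolevSpace d m := by
  intro α _
  induction hf using Submodule.span_induction with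
  | mem f hf =>
    obtain ⟨k, rfl⟩ := hf
    exact ⟨_, hasWeakDeriv_hermiteVec k α⟩
  | zero => exact ⟨_, by simpa using (hasWeakDeriv_hermiteVec 0 α).smul 0⟩
  | add p q _ _ hp hq =>
    obtain ⟨p', hp'⟩ := hp
    obtain ⟨q', hq'⟩ := hq
    exact ⟨_, hp'.add hq'⟩
  | smul c q _ hq =>
    obtain ⟨q', hq'⟩ := hq
    exact ⟨_, hq'.smul c⟩

end GaussianSobolev

namespace GaussianSobolev

/-! ### The Mehler kernel -/

open ProbabilityTheory

variable {d : ℕ}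

theorem exp_neg_two_mul (t : ℝ) : Real.exp (-2 * t) = Real.exp (-t) ^ 2 := by
  rw [← Real.exp_nat_mul]
  congr 1
  push_cast
  ring

theorem mehlerKernel_comm (t : ℝ) (x y : EuclideanSpace ℝ (Fin d)) :
    mehlerKernel t x y = mehlerKernel t y x := by
  simp only [mehlerKernel]
  rw [real_inner_comm]
  ring_nf

theorem mehlerKernel_nonneg {t : ℝ} (ht : 0 < t) (x y : EuclideanSpace ℝ (Fin d)) :
    0 ≤ mehlerKernel t x y := by
  have : 0 ≤ 1 - Real.exp (-2 * t) := by
    rw [sub_nonneg, Real.exp_le_one_iff]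
    linarith
  unfold mehlerKernel
  positivity

theorem measurable_mehlerKernel (t : ℝ) :
    Measurable fun p : EuclideanSpace ℝ (Fin d) × EuclideanSpace ℝ (Fin d) =>
      mehlerKernel t p.1 p.2 := by
  unfold mehlerKernel
  fun_prop

theorem measurable_mehlerKernel_right (t : ℝ) (x : EuclideanSpace ℝ (Fin d)) :
    Measurable fun y => mehlerKernel t x y := by
  unfold mehlerKernel
  fun_prop

/-- The variance `1 - e^{-2t}` of the Ornstein–Uhlenbeck transition kernel. -/
noncomputable def mehlerVariance (t : ℝ) : ℝ≥0 :=
  Real.toNNReal (1 - Real.exp (-t) ^ 2)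

theorem coe_mehlerVariance {t : ℝ} (ht : 0 < t) :
    (mehlerVariance t : ℝ) = 1 - Real.exp (-t) ^ 2 := by
  rw [mehlerVariance, Real.coe_toNNReal]
  rw [← exp_neg_two_mul, sub_nonneg, Real.exp_le_one_iff]
  linarith

theorem mehlerVariance_pos {t : ℝ} (ht : 0 < t) : 0 < (mehlerVariance t : ℝ) := by
  rw [coe_mehlerVariance ht, ← exp_neg_two_mul, sub_pos, Real.exp_lt_one_iff]
  linarith

/-- Completing the square shows that M_t(x,·)γ is the Gaussian law with mean e^{-t}x and covariance
(1-e^{-2t})I, which factors over coordinates. -/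
theorem mehlerKernel_mul_gaussianDensity {t : ℝ} (ht : 0 < t) (x y : EuclideanSpace ℝ (Fin d)) :
    mehlerKernel t x y * gaussianDensity d y =
      ∏ i, gaussianPDFReal (Real.exp (-t) * x i) (mehlerVariance t) (y i) := by
  have hv := coe_mehlerVariance ht
  have hv0 := mehlerVariance_pos ht
  simp only [mehlerKernel, exp_neg_two_mul, ← hv]
  rw [gaussianDensity_eq_prod]
  simp only [gaussianPDFReal]
  set v : ℝ := (mehlerVariance t : ℝ)
  set ρ := Real.exp (-t)
  have hx := EuclideanSpace.real_norm_sq_eq x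
  have hy := EuclideanSpace.real_norm_sq_eq y
  have hxy : (inner ℝ x y : ℝ) = ∑ i, x i * y i := by
    rw [PiLp.inner_apply]
    exact Finset.sum_congr rfl fun i _ => by simp [mul_comm]
  have h1 : 1 / v ^ ((d : ℝ) / 2) = ∏ _i : Fin d, (√v)⁻¹ := by
    rw [Finset.prod_const, Finset.card_univ, Fintype.card_fin, Real.sqrt_eq_rpow, inv_pow,
      ← Real.rpow_natCast, ← Real.rpow_mul hv0.le, one_div]
    ring_nf
  have h2 : Real.exp (-(ρ ^ 2 * ‖x‖ ^ 2 - 2 * ρ * inner ℝ x y + ρ ^ 2 * ‖y‖ ^ 2) / (2 * v)) =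
      ∏ i, Real.exp (-(ρ ^ 2 * x i ^ 2 - 2 * ρ * (x i * y i) + ρ ^ 2 * y i ^ 2) / (2 * v)) := by
    rw [← Real.exp_sum, hx, hy, hxy]
    congr 1
    rw [← Finset.sum_div, Finset.sum_neg_distrib, Finset.sum_add_distrib, Finset.sum_sub_distrib,
      Finset.mul_sum, Finset.mul_sum, Finset.mul_sum]
  rw [h1, h2, ← Finset.prod_mul_distrib, ← Finset.prod_mul_distrib]
  refine Finset.prod_congr rfl fun i _ => ?_
  have e1 : Real.exp (-(ρ ^ 2 * x i ^ 2 - 2 * ρ * (x i * y i) + ρ ^ 2 * y i ^ 2) / (2 * v)) *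
      Real.exp (-(y i - 0) ^ 2 / (2 * (1 : ℝ≥0))) =
      Real.exp (-(y i - ρ * x i) ^ 2 / (2 * v)) := by
    rw [← Real.exp_add]
    congr 1
    rw [NNReal.coe_one]
    field_simp
    rw [hv]
    ring
  rw [← e1, Real.sqrt_mul (by positivity) v, mul_inv, NNReal.coe_one, mul_one]
  ring

theorem integrable_multiHermite_mul_mehlerKernel {t : ℝ} (ht : 0 < t) (k : Fin d → ℕ)
    (x : EuclideanSpace ℝ (Fin d)) :
    Integrable (fun y => multiHermite k y * mehlerKernel t x y) (gaussianMeasure d) := by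
  rw [integrable_gaussianMeasure_iff]
  simp_rw [mul_assoc, mehlerKernel_mul_gaussianDensity ht, multiHermite, ← Finset.prod_mul_distrib]
  have hv : mehlerVariance t ≠ 0 := fun h => (mehlerVariance_pos ht).ne' (by simp [h])
  refine (PiLp.volume_preserving_ofLp (Fin d)).integrable_comp_of_integrable
    (g := fun y : Fin d → ℝ => ∏ i, (hermiteFun (k i) (y i) *
      gaussianPDFReal (Real.exp (-t) * x i) (mehlerVariance t) (y i))) ?_
  refine Integrable.fintype_prod (f := fun i y => hermiteFun (k i) y *
    gaussianPDFReal (Real.exp (-t) * x i) (mehlerVariance t) y) fun i => ?_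
  simpa only [eval_hermitePoly] using integrable_eval_mul_gaussianPDFReal (hermitePoly (k i)) _ hv

/-- Mehler's formula: Hermite polynomials are eigenfunctions of the Ornstein–Uhlenbeck
semigroup. -/
theorem integral_multiHermite_mul_mehlerKernel {t : ℝ} (ht : 0 < t) (k : Fin d → ℕ)
    (x : EuclideanSpace ℝ (Fin d)) :
    ∫ y, multiHermite k y * mehlerKernel t x y ∂gaussianMeasure d =
      Real.exp (-t) ^ (∑ i, k i) * multiHermite k x := by
  have hv : mehlerVariance t ≠ 0 := fun h => (mehlerVariance_pos ht).ne' (by simp [h])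
  have e : ∀ y : EuclideanSpace ℝ (Fin d),
      gaussianDensity d y • (multiHermite k y * mehlerKernel t x y) =
      ∏ i, (gaussianPDFReal (Real.exp (-t) * x i) (mehlerVariance t) (y i) •
        hermiteFun (k i) (y i)) := by
    intro y
    simp only [smul_eq_mul]
    rw [Finset.prod_mul_distrib, ← mehlerKernel_mul_gaussianDensity ht, multiHermite]
    ring
  rw [integral_gaussianMeasure]
  simp_rw [e]
  have h := (PiLp.volume_preserving_ofLp (Fin d)).integral_comp
    (MeasurableEquiv.toLp 2 (Fin d → ℝ)).symm.measurableEmbedding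
    (fun y : Fin d → ℝ => ∏ i, (gaussianPDFReal (Real.exp (-t) * x i) (mehlerVariance t) (y i) •
        hermiteFun (k i) (y i)))
  rw [h, integral_fintype_prod_volume_eq_prod (f := fun i y =>
    gaussianPDFReal (Real.exp (-t) * x i) (mehlerVariance t) y • hermiteFun (k i) y)]
  simp_rw [← integral_gaussianReal_eq_integral_smul hv,
    integral_hermiteFun_gaussianReal _ _ hv (coe_mehlerVariance ht)]
  rw [Finset.prod_mul_distrib, Finset.prod_pow_eq_pow_sum, multiHermite]

/-- Mehler's formula for the constant polynomial H_0 = 1. -/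
theorem lintegral_mehlerKernel {t : ℝ} (ht : 0 < t) (x : EuclideanSpace ℝ (Fin d)) :
    ∫⁻ y, ENNReal.ofReal (mehlerKernel t x y) ∂gaussianMeasure d = 1 := by
  have h0 : ∀ y, multiHermite (0 : Fin d → ℕ) y = 1 := fun y => by simp [multiHermite, hermiteFun]
  have h1 := integrable_multiHermite_mul_mehlerKernel ht 0 x
  have h2 := integral_multiHermite_mul_mehlerKernel ht 0 x
  simp only [h0, one_mul] at h1 h2
  rw [← ofReal_integral_eq_lintegral_ofReal h1 (ae_of_all _ fun y => mehlerKernel_nonneg ht x y),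
    h2]
  simp

/-! ### The Ornstein–Uhlenbeck coupling and the energy of increments -/

/-- The joint law of the stationary Ornstein–Uhlenbeck process at two times with distance `t`. -/
noncomputable def mehlerMeasure (d : ℕ) (t : ℝ) :
    Measure (EuclideanSpace ℝ (Fin d) × EuclideanSpace ℝ (Fin d)) :=
  ((gaussianMeasure d).prod (gaussianMeasure d)).withDensity
    fun p => ENNReal.ofReal (mehlerKernel t p.1 p.2)

theorem measurable_ofReal_mehlerKernel (t : ℝ) :
    Measurable fun p : EuclideanSpace ℝ (Fin d) × EuclideanSpace ℝ (Fin d) =>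
      ENNReal.ofReal (mehlerKernel t p.1 p.2) :=
  (measurable_mehlerKernel t).ennreal_ofReal

/-- The kernel is symmetric and has mass one in each variable, so both marginals of the coupling are
γ. Thus g(x) and g(y) are isometric images of g in one common Hilbert space. -/
theorem measurePreserving_fst_mehlerMeasure {t : ℝ} (ht : 0 < t) :
    MeasurePreserving Prod.fst (mehlerMeasure d t) (gaussianMeasure d) := by
  refine ⟨measurable_fst, Measure.ext_of_lintegral _ fun f hf => ?_⟩
  have hm := measurable_ofReal_mehlerKernel (d := d) t
  have hfm : Measurable fun p : EuclideanSpace ℝ (Fin d) × EuclideanSpace ℝ (Fin d) => f p.1 :=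
    hf.comp measurable_fst
  rw [lintegral_map hf measurable_fst, mehlerMeasure,
    lintegral_withDensity_eq_lintegral_mul _ hm hfm,
    lintegral_prod _ (hm.mul hfm).aemeasurable]
  refine lintegral_congr fun x => ?_
  simp only [Pi.mul_apply]
  rw [lintegral_mul_const _ (measurable_mehlerKernel_right t x).ennreal_ofReal, lintegral_mehlerKernel ht, one_mul]

theorem measurePreserving_snd_mehlerMeasure {t : ℝ} (ht : 0 < t) :
    MeasurePreserving Prod.snd (mehlerMeasure d t) (gaussianMeasure d) := by
  refine ⟨measurable_snd, Measure.ext_of_lintegral _ fun f hf => ?_⟩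
  have hm := measurable_ofReal_mehlerKernel (d := d) t
  have hfm : Measurable fun p : EuclideanSpace ℝ (Fin d) × EuclideanSpace ℝ (Fin d) => f p.2 :=
    hf.comp measurable_snd
  rw [lintegral_map hf measurable_snd, mehlerMeasure,
    lintegral_withDensity_eq_lintegral_mul _ hm hfm,
    lintegral_prod_symm _ (hm.mul hfm).aemeasurable]
  refine lintegral_congr fun y => ?_
  simp only [Pi.mul_apply]
  simp_rw [mehlerKernel_comm t _ y]
  rw [lintegral_mul_const _ (measurable_mehlerKernel_right t y).ennreal_ofReal, lintegral_mehlerKernel ht, one_mul]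

/-- Composition with a measure preserving map, as a linear isometry of `L_2` spaces. -/
noncomputable def compIsometry {Ω : Type*} [MeasurableSpace Ω] {μ : Measure Ω}
    {T : Ω → EuclideanSpace ℝ (Fin d)} (hT : MeasurePreserving T μ (gaussianMeasure d)) :
    L2Gaussian d →ₗᵢ[ℝ] Lp ℝ 2 μ :=
  Lp.compMeasurePreservingₗᵢ ℝ T hT

theorem coeFn_compIsometry {Ω : Type*} [MeasurableSpace Ω] {μ : Measure Ω}
    {T : Ω → EuclideanSpace ℝ (Fin d)} (hT : MeasurePreserving T μ (gaussianMeasure d))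
    (g : L2Gaussian d) : compIsometry hT g =ᵐ[μ] g ∘ T :=
  Lp.coeFn_compMeasurePreserving g hT

/-- Integrating first in y turns H_k(y) into e^{-t|k|} H_k(x) by Mehler's formula; orthonormality
finishes. -/
theorem inner_compIsometry_hermiteVec {t : ℝ} (ht : 0 < t) (j k : Fin d → ℕ) :
    inner ℝ (compIsometry (measurePreserving_fst_mehlerMeasure ht) (hermiteVec j))
      (compIsometry (measurePreserving_snd_mehlerMeasure ht) (hermiteVec k)) =
      if j = k then Real.exp (-t) ^ (∑ i, k i) else 0 := by
  have h1 := measurePreserving_fst_mehlerMeasure (d := d) ht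
  have h2 := measurePreserving_snd_mehlerMeasure (d := d) ht
  have hi : Integrable (fun p : EuclideanSpace ℝ (Fin d) × EuclideanSpace ℝ (Fin d) =>
      multiHermite j p.1 * multiHermite k p.2) (mehlerMeasure d t) :=
    ((memLp_multiHermite j).comp_measurePreserving h1).integrable_mul
      ((memLp_multiHermite k).comp_measurePreserving h2)
  have hm := measurable_ofReal_mehlerKernel (d := d) t
  have hi' := hi
  rw [mehlerMeasure, integrable_withDensity_iff_integrable_smul' hm
    (ae_of_all _ fun p => ENNReal.ofReal_lt_top)] at hi'
  rw [L2.inner_def]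
  have e : ∫ p, inner ℝ (compIsometry h1 (hermiteVec j) p) (compIsometry h2 (hermiteVec k) p)
      ∂mehlerMeasure d t = ∫ p, multiHermite j p.1 * multiHermite k p.2 ∂mehlerMeasure d t := by
    refine integral_congr_ae ?_
    filter_upwards [coeFn_compIsometry h1 (hermiteVec j), coeFn_compIsometry h2 (hermiteVec k),
      h1.quasiMeasurePreserving.ae_eq_comp (coeFn_hermiteVec j),
      h2.quasiMeasurePreserving.ae_eq_comp (coeFn_hermiteVec k)] with p a1 a2 a3 a4
    rw [a1, a2, a3, a4]
    simp [mul_comm]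
  rw [e, mehlerMeasure, integral_withDensity_eq_integral_toReal_smul hm
    (ae_of_all _ fun p => ENNReal.ofReal_lt_top), integral_prod _ hi']
  have e2 : ∀ x, ∫ y, (ENNReal.ofReal (mehlerKernel t x y)).toReal •
      (multiHermite j x * multiHermite k y) ∂gaussianMeasure d =
      Real.exp (-t) ^ (∑ i, k i) * (multiHermite j x * multiHermite k x) := by
    intro x
    rw [mul_left_comm, ← integral_multiHermite_mul_mehlerKernel ht, ← integral_const_mul]
    refine integral_congr_ae (ae_of_all _ fun y => ?_)
    simp only [smul_eq_mul]
    rw [ENNReal.toReal_ofReal (mehlerKernel_nonneg ht x y)]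
    ring
  simp only [e2]
  rw [integral_const_mul, integral_multiHermite_mul]
  simp

/-- Both isometries are continuous, so g and then h may be expanded in the Hermite basis inside the
inner product; only diagonal terms survive. -/
theorem hasSum_inner_compIsometry {t : ℝ} (ht : 0 < t) (g h : L2Gaussian d) :
    HasSum (fun k => Real.exp (-t) ^ (∑ i, k i) * (hermiteCoeff g k * hermiteCoeff h k))
      (inner ℝ (compIsometry (measurePreserving_fst_mehlerMeasure ht) g)
        (compIsometry (measurePreserving_snd_mehlerMeasure ht) h)) := by
  set U := (compIsometry (measurePreserving_fst_mehlerMeasure (d := d) ht)).toContinuousLinearMap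
  set V := (compIsometry (measurePreserving_snd_mehlerMeasure (d := d) ht)).toContinuousLinearMap
  have hexp : ∀ f : L2Gaussian d, HasSum (fun k => hermiteCoeff f k • hermiteVec k) f := by
    intro f
    have := (hermiteBasis d).hasSum_repr f
    simpa only [HilbertBasis.repr_apply_apply, hermiteBasis_apply, ← hermiteCoeff_eq_inner]
      using this
  have hk : ∀ k, inner ℝ (U g) (V (hermiteVec k)) =
      Real.exp (-t) ^ (∑ i, k i) * hermiteCoeff g k := by
    intro k
    have h1 := (hexp g).mapL ((innerSL ℝ (V (hermiteVec k))).comp U)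
    have h2 : HasSum (fun j => ((innerSL ℝ (V (hermiteVec k))).comp U)
        (hermiteCoeff g j • hermiteVec j)) (Real.exp (-t) ^ (∑ i, k i) * hermiteCoeff g k) := by
      have h3 : ∀ j, ((innerSL ℝ (V (hermiteVec k))).comp U) (hermiteCoeff g j • hermiteVec j) =
          if j = k then Real.exp (-t) ^ (∑ i, k i) * hermiteCoeff g k else 0 := by
        intro j
        have := inner_compIsometry_hermiteVec ht j k
        rw [map_smul, ContinuousLinearMap.comp_apply, innerSL_apply_apply, real_inner_comm]
        change _ • inner ℝ (compIsometry _ _) (compIsometry _ _) = _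
        rw [this]
        by_cases hjk : j = k
        · simp [hjk, mul_comm]
        · simp [hjk]
      simp_rw [h3]
      exact hasSum_ite_eq k _
    have := h1.unique h2
    rwa [ContinuousLinearMap.comp_apply, innerSL_apply_apply, real_inner_comm] at this
  have := (hexp h).mapL ((innerSL ℝ (U g)).comp V)
  refine (this.congr_fun fun k => ?_)
  rw [map_smul, ContinuousLinearMap.comp_apply, innerSL_apply_apply, hk, smul_eq_mul]
  ring

/-- Expand the square: each of the two norms equals ‖g‖, and the cross term is diagonal with factor
e^{-t|k|}. -/
theorem hasSum_norm_sub_compIsometry_sq {t : ℝ} (ht : 0 < t) (g : L2Gaussian d) :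
    HasSum (fun k => 2 * (1 - Real.exp (-t) ^ (∑ i, k i)) * hermiteCoeff g k ^ 2)
      (‖compIsometry (measurePreserving_fst_mehlerMeasure ht) g -
        compIsometry (measurePreserving_snd_mehlerMeasure ht) g‖ ^ 2) := by
  rw [norm_sub_sq_real, LinearIsometry.norm_map, LinearIsometry.norm_map]
  have h1 := hasSum_hermiteCoeff_sq g
  have h2 := hasSum_inner_compIsometry ht g g
  refine ((h1.sub (h2.mul_left 2)).add h1).congr_fun fun k => ?_
  ring

theorem lintegral_enorm_sub_sq_mul_mehlerKernel {t : ℝ} (ht : 0 < t) (g : L2Gaussian d) :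
    ∫⁻ p, ‖g p.1 - g p.2‖ₑ ^ (2 : ℝ) * ENNReal.ofReal (mehlerKernel t p.1 p.2)
      ∂(gaussianMeasure d).prod (gaussianMeasure d) =
      ∑' k, ENNReal.ofReal (2 * (1 - Real.exp (-t) ^ (∑ i, k i)) * hermiteCoeff g k ^ 2) := by
  have hs := hasSum_norm_sub_compIsometry_sq ht g
  have hpos : ∀ k : Fin d → ℕ,
      0 ≤ 2 * (1 - Real.exp (-t) ^ (∑ i, k i)) * hermiteCoeff g k ^ 2 := by
    intro k
    have : Real.exp (-t) ^ (∑ i, k i) ≤ 1 :=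
      pow_le_one₀ (Real.exp_pos _).le (Real.exp_le_one_iff.2 (by linarith))
    have h' : 0 ≤ 1 - Real.exp (-t) ^ (∑ i, k i) := by linarith
    positivity
  rw [← ENNReal.ofReal_tsum_of_nonneg hpos hs.summable, hs.tsum_eq,
    ENNReal.ofReal_pow (norm_nonneg _), ofReal_norm, Lp.enorm_def,
    eLpNorm_eq_lintegral_rpow_enorm_toReal (by norm_num) (by norm_num), ← ENNReal.rpow_natCast,
    ← ENNReal.rpow_mul]
  have hm := measurable_ofReal_mehlerKernel (d := d) t
  have hg : Measurable g := (Lp.stronglyMeasurable g).measurable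
  have hgm : Measurable fun p : EuclideanSpace ℝ (Fin d) × EuclideanSpace ℝ (Fin d) =>
      ‖g p.1 - g p.2‖ₑ ^ (2 : ℝ) :=
    ((hg.comp measurable_fst).sub (hg.comp measurable_snd)).enorm.pow_const _
  have e : ∫⁻ p, ‖(compIsometry (measurePreserving_fst_mehlerMeasure ht) g -
      compIsometry (measurePreserving_snd_mehlerMeasure ht) g :
        Lp ℝ 2 (mehlerMeasure d t)) p‖ₑ ^ (2 : ℝ) ∂mehlerMeasure d t =
      ∫⁻ p, ‖g p.1 - g p.2‖ₑ ^ (2 : ℝ) ∂mehlerMeasure d t := by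
    refine lintegral_congr_ae ?_
    filter_upwards [coeFn_compIsometry (measurePreserving_fst_mehlerMeasure ht) g,
      coeFn_compIsometry (measurePreserving_snd_mehlerMeasure ht) g,
      Lp.coeFn_sub (compIsometry (measurePreserving_fst_mehlerMeasure ht) g)
        (compIsometry (measurePreserving_snd_mehlerMeasure ht) g)] with p h1 h2 h3
    rw [h3, Pi.sub_apply, h1, h2]
    rfl
  simp only [ENNReal.toReal_ofNat]
  rw [e, mehlerMeasure, lintegral_withDensity_eq_lintegral_mul _ hm hgm]
  norm_num
  simp_rw [mul_comm]

/-! ### The fractional seminorm -/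

/-- Near zero 1-e^{-t} ≤ t, which suffices because θ < 1; at infinity 1-e^{-t} ≤ 1, which suffices
because θ > 0. -/
theorem integrableOn_one_sub_exp_mul_rpow {θ : ℝ} (h0 : 0 < θ) (h1 : θ < 1) :
    IntegrableOn (fun t : ℝ => 2 * (1 - Real.exp (-t)) * t ^ (-(θ + 1))) (Set.Ioi 0) := by
  have hm : AEStronglyMeasurable (fun t : ℝ => 2 * (1 - Real.exp (-t)) * t ^ (-(θ + 1))) volume := by
    have : Measurable (fun t : ℝ => 2 * (1 - Real.exp (-t)) * t ^ (-(θ + 1))) := by fun_prop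
    exact this.aestronglyMeasurable
  rw [← Set.Ioc_union_Ioi_eq_Ioi (zero_le_one (α := ℝ)), integrableOn_union]
  constructor
  · have : IntegrableOn (fun t : ℝ => 2 * t ^ (-θ)) (Set.Ioc 0 1) := by
      have := (intervalIntegral.intervalIntegrable_rpow' (a := 0) (b := 1) (r := -θ)
        (by linarith)).const_mul 2
      rwa [intervalIntegrable_iff_integrableOn_Ioc_of_le zero_le_one] at this
    refine this.mono' hm.restrict ?_
    filter_upwards [ae_restrict_mem measurableSet_Ioc] with t ht
    have e1 : 0 ≤ 1 - Real.exp (-t) := by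
      rw [sub_nonneg, Real.exp_le_one_iff]
      linarith [ht.1]
    have e2 : 1 - Real.exp (-t) ≤ t := by linarith [Real.add_one_le_exp (-t)]
    have e3 : t ^ (-(θ + 1)) * t = t ^ (-θ) := by
      nth_rewrite 2 [← Real.rpow_one t]
      rw [← Real.rpow_add ht.1]
      ring_nf
    have e4 : 0 ≤ t ^ (-(θ + 1)) := Real.rpow_nonneg ht.1.le _
    rw [Real.norm_of_nonneg (by positivity), ← e3]
    nlinarith [mul_le_mul_of_nonneg_right e2 e4]
  · have : IntegrableOn (fun t : ℝ => 2 * t ^ (-(θ + 1))) (Set.Ioi 1) :=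
      (integrableOn_Ioi_rpow_of_lt (by linarith) zero_lt_one).const_mul 2
    refine this.mono' hm.restrict ?_
    filter_upwards [ae_restrict_mem measurableSet_Ioi] with t ht
    have ht' : 0 < t := zero_lt_one.trans ht
    have e1 : 0 ≤ 1 - Real.exp (-t) := by
      rw [sub_nonneg, Real.exp_le_one_iff]
      linarith
    have e2 : 1 - Real.exp (-t) ≤ 1 := by linarith [Real.exp_pos (-t)]
    have e4 : 0 ≤ t ^ (-(θ + 1)) := Real.rpow_nonneg ht'.le _
    rw [Real.norm_of_nonneg (by positivity)]
    nlinarith [mul_le_mul_of_nonneg_right e2 e4]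

/-- The constant `∫_0^∞ 2 (1 - e^{-t}) t^{-θ-1} dt`. -/
noncomputable def fracConst (θ : ℝ) : ℝ :=
  ∫ t in Set.Ioi (0 : ℝ), 2 * (1 - Real.exp (-t)) * t ^ (-(θ + 1))

theorem fracConst_pos {θ : ℝ} (h0 : 0 < θ) (h1 : θ < 1) : 0 < fracConst θ := by
  have hpos : ∀ t ∈ Set.Ioi (0 : ℝ), 0 < 2 * (1 - Real.exp (-t)) * t ^ (-(θ + 1)) := by
    intro t ht
    have e1 : 0 < 1 - Real.exp (-t) := by
      rw [sub_pos, Real.exp_lt_one_iff]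
      linarith [Set.mem_Ioi.1 ht]
    have := Real.rpow_pos_of_pos ht (-(θ + 1))
    positivity
  rw [fracConst, setIntegral_pos_iff_support_of_nonneg_ae
    ((ae_restrict_mem measurableSet_Ioi).mono fun t ht => (hpos t ht).le)
    (integrableOn_one_sub_exp_mul_rpow h0 h1)]
  have : Set.Ioi (0 : ℝ) ⊆ Function.support (fun t : ℝ => 2 * (1 - Real.exp (-t)) * t ^ (-(θ + 1))) ∩
      Set.Ioi 0 := fun t ht => ⟨(hpos t ht).ne', ht⟩
  refine lt_of_lt_of_le ?_ (measure_mono this)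
  simp

/-- The substitution u = nt extracts n^θ. For n = 0 both sides vanish, since θ > 0 gives 0^θ = 0. -/
theorem lintegral_one_sub_exp_pow_mul_rpow {θ : ℝ} (h0 : 0 < θ) (h1 : θ < 1) (n : ℕ) :
    ∫⁻ t in Set.Ioi (0 : ℝ), ENNReal.ofReal (2 * (1 - Real.exp (-t) ^ n) * t ^ (-(θ + 1))) =
      ENNReal.ofReal (fracConst θ * (n : ℝ) ^ θ) := by
  rcases Nat.eq_zero_or_pos n with rfl | hn
  · simp [Real.zero_rpow h0.ne']
  have hn' : (0 : ℝ) < n := by exact_mod_cast hn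
  set g : ℝ → ℝ := fun t => 2 * (1 - Real.exp (-t)) * t ^ (-(θ + 1)) with hg
  have hgi : IntegrableOn g (Set.Ioi 0) := integrableOn_one_sub_exp_mul_rpow h0 h1
  have e : ∀ t ∈ Set.Ioi (0 : ℝ), 2 * (1 - Real.exp (-t) ^ n) * t ^ (-(θ + 1)) =
      (n : ℝ) ^ (θ + 1) * g (n * t) := by
    intro t ht
    simp only [hg]
    rw [← Real.exp_nat_mul, Real.mul_rpow hn'.le (le_of_lt ht), Real.rpow_neg hn'.le]
    have := (Real.rpow_pos_of_pos hn' (θ + 1)).ne'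
    field_simp
  rw [setLIntegral_congr_fun measurableSet_Ioi (fun t ht => by rw [e t ht])]
  have hgi' : IntegrableOn (fun t => (n : ℝ) ^ (θ + 1) * g (n * t)) (Set.Ioi 0) := by
    refine Integrable.const_mul ?_ _
    have := (integrableOn_Ioi_comp_mul_left_iff g 0 hn').2 (by simpa using hgi)
    exact this
  rw [← ofReal_integral_eq_lintegral_ofReal hgi', integral_const_mul,
    integral_comp_mul_left_Ioi g 0 hn', mul_zero, smul_eq_mul, Real.rpow_add_one hn'.ne', fracConst]
  · congr 1
    field_simp
    rfl
  · filter_upwards [ae_restrict_mem measurableSet_Ioi] with t ht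
    rw [← e t ht]
    have : Real.exp (-t) ^ n ≤ 1 :=
      pow_le_one₀ (Real.exp_pos _).le (Real.exp_le_one_iff.2 (by linarith [Set.mem_Ioi.1 ht]))
    have h' : 0 ≤ 1 - Real.exp (-t) ^ n := by linarith
    have := Real.rpow_nonneg (le_of_lt ht) (-(θ + 1))
    simp only [Pi.zero_apply]
    positivity

theorem measurable_enorm_sub_rpow (g : L2Gaussian d) :
    Measurable fun p : EuclideanSpace ℝ (Fin d) × EuclideanSpace ℝ (Fin d) =>
      ‖g p.1 - g p.2‖ₑ ^ (2 : ℝ) := by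
  have hg : Measurable g := (Lp.stronglyMeasurable g).measurable
  exact ((hg.comp measurable_fst).sub (hg.comp measurable_snd)).enorm.pow_const _

theorem measurable_ofReal_mehlerKernel_div (r : ℝ) :
    Measurable fun q : (EuclideanSpace ℝ (Fin d) × EuclideanSpace ℝ (Fin d)) × ℝ =>
      ENNReal.ofReal (mehlerKernel q.2 q.1.1 q.1.2 / q.2 ^ r) := by
  have h : Measurable fun q : (EuclideanSpace ℝ (Fin d) × EuclideanSpace ℝ (Fin d)) × ℝ =>
      mehlerKernel q.2 q.1.1 q.1.2 := by
    unfold mehlerKernel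
    fun_prop
  exact (h.div (measurable_snd.pow_const r)).ennreal_ofReal

theorem measurable_fracKernel (σ : ℝ) :
    Measurable fun p : EuclideanSpace ℝ (Fin d) × EuclideanSpace ℝ (Fin d) =>
      fracKernel σ p.1 p.2 :=
  (measurable_ofReal_mehlerKernel_div (σ / 2 + 1)).lintegral_prod_right'

theorem lintegral_enorm_sub_sq_mul_mehlerKernel_div {t : ℝ} (ht : 0 < t) (θ : ℝ)
    (g : L2Gaussian d) :
    ∫⁻ p, ‖g p.1 - g p.2‖ₑ ^ (2 : ℝ) *
      ENNReal.ofReal (mehlerKernel t p.1 p.2 / t ^ (2 * θ / 2 + 1))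
        ∂(gaussianMeasure d).prod (gaussianMeasure d) =
      ∑' k : Fin d → ℕ, ENNReal.ofReal (hermiteCoeff g k ^ 2) *
        ENNReal.ofReal (2 * (1 - Real.exp (-t) ^ (∑ i, k i)) * t ^ (-(θ + 1))) := by
  have ht' : 0 ≤ t ^ (-(θ + 1)) := Real.rpow_nonneg ht.le _
  have e3 : ∀ p : EuclideanSpace ℝ (Fin d) × EuclideanSpace ℝ (Fin d),
      ‖g p.1 - g p.2‖ₑ ^ (2 : ℝ) *
        ENNReal.ofReal (mehlerKernel t p.1 p.2 / t ^ (2 * θ / 2 + 1)) =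
      ENNReal.ofReal (t ^ (-(θ + 1))) *
        (‖g p.1 - g p.2‖ₑ ^ (2 : ℝ) * ENNReal.ofReal (mehlerKernel t p.1 p.2)) := by
    intro p
    rw [mul_div_cancel_left₀ _ (two_ne_zero' ℝ), div_eq_inv_mul,
      ← Real.rpow_neg ht.le, ENNReal.ofReal_mul ht', mul_left_comm]
  simp_rw [e3]
  have hm : Measurable fun p : EuclideanSpace ℝ (Fin d) × EuclideanSpace ℝ (Fin d) =>
      ‖g p.1 - g p.2‖ₑ ^ (2 : ℝ) * ENNReal.ofReal (mehlerKernel t p.1 p.2) :=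
    (measurable_enorm_sub_rpow g).mul (measurable_ofReal_mehlerKernel t)
  rw [lintegral_const_mul _ hm,
    lintegral_enorm_sub_sq_mul_mehlerKernel ht, ← ENNReal.tsum_mul_left]
  refine tsum_congr fun k => ?_
  rw [← ENNReal.ofReal_mul ht', ← ENNReal.ofReal_mul (sq_nonneg _)]
  congr 1
  ring

theorem lintegral_enorm_sub_sq_mul_fracKernel_eq_lintegral_prod (σ : ℝ) (g : L2Gaussian d) :
    ∫⁻ y, ∫⁻ x, ‖g x - g y‖ₑ ^ (2 : ℝ) * fracKernel σ x y
      ∂gaussianMeasure d ∂gaussianMeasure d =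
    ∫⁻ p, ‖g p.1 - g p.2‖ₑ ^ (2 : ℝ) * fracKernel σ p.1 p.2
      ∂(gaussianMeasure d).prod (gaussianMeasure d) := by
  have hm : Measurable fun p : EuclideanSpace ℝ (Fin d) × EuclideanSpace ℝ (Fin d) =>
      ‖g p.1 - g p.2‖ₑ ^ (2 : ℝ) * fracKernel σ p.1 p.2 :=
    (measurable_enorm_sub_rpow g).mul (measurable_fracKernel σ)
  exact (lintegral_prod_symm' _ hm).symm

/-- The fractional energy of a function in terms of its Hermite coefficients. -/
theorem lintegral_enorm_sub_sq_mul_fracKernel {θ : ℝ} (h0 : 0 < θ) (h1 : θ < 1)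
    (g : L2Gaussian d) :
    ∫⁻ y, ∫⁻ x, ‖g x - g y‖ₑ ^ (2 : ℝ) * fracKernel (2 * θ) x y
      ∂gaussianMeasure d ∂gaussianMeasure d =
      ∑' k, ENNReal.ofReal (fracConst θ * ((∑ i, k i : ℕ) : ℝ) ^ θ * hermiteCoeff g k ^ 2) := by
  rw [lintegral_enorm_sub_sq_mul_fracKernel_eq_lintegral_prod]
  have hkm := measurable_ofReal_mehlerKernel_div (d := d) (2 * θ / 2 + 1)
  have e1 : ∀ p : EuclideanSpace ℝ (Fin d) × EuclideanSpace ℝ (Fin d),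
      ‖g p.1 - g p.2‖ₑ ^ (2 : ℝ) * fracKernel (2 * θ) p.1 p.2 =
      ∫⁻ t in Set.Ioi (0 : ℝ), ‖g p.1 - g p.2‖ₑ ^ (2 : ℝ) *
        ENNReal.ofReal (mehlerKernel t p.1 p.2 / t ^ (2 * θ / 2 + 1)) := fun p =>
    (lintegral_const_mul _ (hkm.comp measurable_prodMk_left)).symm
  simp_rw [e1]
  have hm : Measurable fun q : (EuclideanSpace ℝ (Fin d) × EuclideanSpace ℝ (Fin d)) × ℝ =>
      ‖g q.1.1 - g q.1.2‖ₑ ^ (2 : ℝ) *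
        ENNReal.ofReal (mehlerKernel q.2 q.1.1 q.1.2 / q.2 ^ (2 * θ / 2 + 1)) :=
    ((measurable_enorm_sub_rpow g).comp measurable_fst).mul hkm
  -- Tonelli puts the time integral outside, so the increment energy can be diagonalized at each
  -- fixed t before integrating termwise.
  rw [lintegral_lintegral_swap hm.aemeasurable, setLIntegral_congr_fun measurableSet_Ioi
    fun t ht => lintegral_enorm_sub_sq_mul_mehlerKernel_div ht θ g, lintegral_tsum]
  · refine tsum_congr fun k => ?_
    rw [lintegral_const_mul _ (by fun_prop), lintegral_one_sub_exp_pow_mul_rpow h0 h1,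
      ← ENNReal.ofReal_mul (sq_nonneg _), mul_comm]
  · intro k
    fun_prop

end GaussianSobolev

namespace GaussianSobolev

/-! ### Comparison of the Sobolev and Hermite norms -/

variable {d : ℕ}

theorem descFactorialProd_eq_zero {k α : Fin d → ℕ} (h : ¬ α ≤ k) : descFactorialProd k α = 0 := by
  obtain ⟨i, hi⟩ := not_forall.1 h
  exact Finset.prod_eq_zero (Finset.mem_univ i)
    (Nat.descFactorial_eq_zero_iff_lt.2 (not_le.1 hi))

theorem descFactorialProd_le_pow (k α : Fin d → ℕ) :
    descFactorialProd k α ≤ (∑ i, k i) ^ (∑ i, α i) := by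
  rw [← Finset.prod_pow_eq_pow_sum]
  refine Finset.prod_le_prod' fun i _ => (Nat.descFactorial_le_pow _ _).trans ?_
  exact Nat.pow_le_pow_left (Finset.single_le_sum (fun _ _ => Nat.zero_le _) (Finset.mem_univ i)) _

theorem descFactorialProd_single (k : Fin d → ℕ) (i : Fin d) (m : ℕ) :
    descFactorialProd k (Pi.single i m) = (k i).descFactorial m := by
  rw [descFactorialProd, Finset.prod_eq_single i]
  · simp
  · intro j _ hj
    simp [hj]
  · simp

theorem tsum_add_eq_tsum (α : Fin d → ℕ) (F : (Fin d → ℕ) → ℝ≥0∞) (hF : ∀ k, ¬ α ≤ k → F k = 0) :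
    ∑' k, F (k + α) = ∑' k, F k := by
  refine (add_left_injective α).tsum_eq (f := F) fun k hk => ?_
  have h : α ≤ k := by
    by_contra h
    exact hk (hF k h)
  exact ⟨k - α, tsub_add_cancel_of_le h⟩

/-- Reindexing by k ↦ k+α loses nothing, because the falling factorial vanishes off the range α ≤ k.
The weight w is constant for L_2 norms and a multiple of |k|^θ for fractional energies. -/
theorem tsum_mul_hermiteCoeff_weakDeriv_sq {m : ℕ} {f : L2Gaussian d}
    (hf : f ∈ intSobolevSpace d m) {α : Fin d → ℕ} (hα : ∑ i, α i ≤ m) (w : (Fin d → ℕ) → ℝ) :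
    ∑' k, ENNReal.ofReal (w k * hermiteCoeff (weakDeriv α f) k ^ 2) =
      ∑' k, ENNReal.ofReal (w (k - α) * descFactorialProd k α * hermiteCoeff f k ^ 2) := by
  rw [← tsum_add_eq_tsum α fun k =>
    ENNReal.ofReal (w (k - α) * descFactorialProd k α * hermiteCoeff f k ^ 2)]
  · refine tsum_congr fun k => ?_
    rw [hermiteCoeff_weakDeriv hf hα, mul_pow, Real.sq_sqrt (by positivity), add_tsub_cancel_right,
      mul_assoc]
  · intro k hk
    simp [descFactorialProd_eq_zero hk]

theorem enorm_weakDeriv_sq {m : ℕ} {f : L2Gaussian d} (hf : f ∈ intSobolevSpace d m)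
    {α : Fin d → ℕ} (hα : ∑ i, α i ≤ m) :
    ‖weakDeriv α f‖ₑ ^ 2 = ∑' k, ENNReal.ofReal (descFactorialProd k α * hermiteCoeff f k ^ 2) := by
  have := tsum_mul_hermiteCoeff_weakDeriv_sq hf hα fun _ => 1
  simpa only [one_mul, ← enorm_sq_eq_tsum] using this

/-- The square of the norm of `H^s`. -/
noncomputable def hermiteEnergy (d : ℕ) (s : ℝ) (f : L2Gaussian d) : ℝ≥0∞ :=
  ∑' k : Fin d → ℕ, ENNReal.ofReal ((1 + ∑ i, (k i : ℝ)) ^ s * |hermiteCoeff f k| ^ 2)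

theorem hermiteNorm_eq (s : ℝ) (f : L2Gaussian d) :
    hermiteNorm d s f = hermiteEnergy d s f ^ (1 / 2 : ℝ) := rfl

theorem enorm_weakDeriv_sq_le_intSobolevNorm_sq (m : ℕ) (f : L2Gaussian d)
    {α : Fin d → ℕ} (hα : ∑ i, α i ≤ m) :
    ‖weakDeriv α f‖ₑ ^ 2 ≤ intSobolevNorm d m f ^ 2 := by
  have hsq : ∀ a : ℝ≥0∞, (a ^ (1 / 2 : ℝ)) ^ 2 = a := fun a => by
    rw [← ENNReal.rpow_natCast, ← ENNReal.rpow_mul]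
    norm_num
  rw [intSobolevNorm, hsq]
  simp only [ENNReal.rpow_ofNat]
  have h1 : ‖weakDeriv α f‖ₑ ^ 2 ≤
      ∑ β ∈ (Finset.univ : Finset (Fin d)).piAntidiag (∑ i, α i), ‖weakDeriv β f‖ₑ ^ 2 :=
    Finset.single_le_sum (f := fun β => ‖weakDeriv β f‖ₑ ^ 2) (fun _ _ => zero_le) (by simp)
  refine h1.trans ?_
  exact Finset.single_le_sum (f := fun k => ∑ β ∈ (Finset.univ : Finset (Fin d)).piAntidiag k,
    ‖weakDeriv β f‖ₑ ^ 2) (fun _ _ => zero_le) (by simp; omega)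

theorem weakDeriv_zero {m : ℕ} {f : L2Gaussian d} (hf : f ∈ intSobolevSpace d m) :
    weakDeriv 0 f = f :=
  eq_of_hasWeakDeriv_zero (weakDeriv_spec hf (by simp))

theorem fracSeminorm_eq {s : ℝ} (hs : Int.fract s ≠ 0) (f : L2Gaussian d) :
    fracSeminorm d s f = ∑ α ∈ (Finset.univ : Finset (Fin d)).piAntidiag ⌊s⌋₊,
      (∑' k, ENNReal.ofReal (fracConst (Int.fract s) * ((∑ i, k i : ℕ) : ℝ) ^ Int.fract s *
        hermiteCoeff (weakDeriv α f) k ^ 2)) ^ (1 / 2 : ℝ) := by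
  have h0 : 0 < Int.fract s := lt_of_le_of_ne (Int.fract_nonneg s) hs.symm
  rw [fracSeminorm]
  refine Finset.sum_congr rfl fun α _ => ?_
  rw [lintegral_enorm_sub_sq_mul_fracKernel h0 (Int.fract_lt_one s)]

theorem natFloor_add_fract {s : ℝ} (hs : 0 ≤ s) : (⌊s⌋₊ : ℝ) + Int.fract s = s := by
  rw [natCast_floor_eq_intCast_floor hs, Int.floor_add_fract]

/-- The weight of `H^s` is controlled by the weights of the pure derivatives of order `⌊s⌋`. -/
theorem exists_one_add_sum_rpow_le (hd : 1 ≤ d) {s : ℝ} (hs : 0 < s) :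
    ∃ C : ℝ, 0 < C ∧ ∀ k : Fin d → ℕ, (1 + ∑ i, (k i : ℝ)) ^ s ≤
      C * (1 + ∑ i, ((∑ j, (k - Pi.single i ⌊s⌋₊ : Fin d → ℕ) j : ℕ) : ℝ) ^ Int.fract s *
        descFactorialProd k (Pi.single i ⌊s⌋₊)) := by
  set m := ⌊s⌋₊ with hm
  set θ := Int.fract s with hθ
  have hθ0 : 0 ≤ θ := Int.fract_nonneg s
  have hsum : (m : ℝ) + θ = s := natFloor_add_fract hs.le
  -- The first term serves multi-indices with all entries at most 2m. The second comes from 1+|k| ≤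
  -- (d+1)k_i = 2(d+1)·(k_i/2) for the largest entry k_i.
  refine ⟨(1 + 2 * d * m) ^ s + (2 * (d + 1)) ^ s, by positivity, fun k => ?_⟩
  set R : Fin d → ℝ := fun i => ((∑ j, (k - Pi.single i m : Fin d → ℕ) j : ℕ) : ℝ) ^ θ *
        descFactorialProd k (Pi.single i m) with hR
  have hR0 : ∀ i, 0 ≤ R i := fun i => by positivity
  have hRsum : 0 ≤ ∑ i, R i := Finset.sum_nonneg fun i _ => hR0 i
  have : Nonempty (Fin d) := ⟨⟨0, hd⟩⟩
  obtain ⟨i, -, hi⟩ := Finset.exists_max_image Finset.univ k Finset.univ_nonempty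
  have hle : ∑ j, (k j : ℝ) ≤ d * k i := by
    calc ∑ j, (k j : ℝ) ≤ ∑ _j : Fin d, (k i : ℝ) :=
          Finset.sum_le_sum fun j hj => by exact_mod_cast hi j hj
      _ = d * k i := by simp
  have hk0 : 0 ≤ ∑ j, (k j : ℝ) := Finset.sum_nonneg fun j _ => by positivity
  -- Beyond the threshold 2m, both |k-me_i| and every factor of the falling factorial are at least
  -- k_i/2, so the i-th summand alone is at least (k_i/2)^s.
  rcases le_or_gt (k i) (2 * m) with h | h
  · have h1 : (1 + ∑ j, (k j : ℝ)) ^ s ≤ (1 + 2 * d * m) ^ s := by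
      refine Real.rpow_le_rpow (by positivity) ?_ hs.le
      have : (k i : ℝ) ≤ 2 * m := by exact_mod_cast h
      have := mul_le_mul_of_nonneg_left this (Nat.cast_nonneg d : (0 : ℝ) ≤ d)
      linarith
    have h2 : 0 ≤ (2 * ((d : ℝ) + 1)) ^ s := by positivity
    have h3 : 0 ≤ (1 + 2 * (d : ℝ) * m) ^ s := by positivity
    nlinarith [mul_nonneg h2 hRsum, mul_nonneg h3 hRsum]
  · have h' : 2 * (m : ℝ) + 1 ≤ k i := by exact_mod_cast h
    have hki : (0 : ℝ) < k i := by
      have : (0 : ℝ) ≤ m := by positivity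
      linarith
    have hm0 : (0 : ℝ) ≤ m := by positivity
    have hdesc : ((k i : ℝ) / 2) ^ m ≤ descFactorialProd k (Pi.single i m) := by
      rw [descFactorialProd_single]
      have := Nat.pow_sub_le_descFactorial (k i) m
      have h2 : ((k i + 1 - m : ℕ) : ℝ) ^ m ≤ ((k i).descFactorial m : ℝ) := by exact_mod_cast this
      refine le_trans (pow_le_pow_left₀ (by positivity) ?_ m) h2
      rw [Nat.cast_sub (by omega)]
      push_cast
      linarith
    have hshift : (k i : ℝ) / 2 ≤ ((∑ j, (k - Pi.single i m : Fin d → ℕ) j : ℕ) : ℝ) := by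
      have : k i - m ≤ ∑ j, (k - Pi.single i m : Fin d → ℕ) j := by
        have := Finset.single_le_sum (f := fun j => (k - Pi.single i m : Fin d → ℕ) j)
          (fun _ _ => Nat.zero_le _) (Finset.mem_univ i)
        simpa using this
      have h2 : ((k i - m : ℕ) : ℝ) ≤ ((∑ j, (k - Pi.single i m : Fin d → ℕ) j : ℕ) : ℝ) := by
        exact_mod_cast this
      rw [Nat.cast_sub (by omega)] at h2
      linarith
    have hRi : ((k i : ℝ) / 2) ^ s ≤ R i := by
      rw [← hsum, Real.rpow_add (by positivity), Real.rpow_natCast, mul_comm]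
      exact mul_le_mul (Real.rpow_le_rpow (by positivity) hshift hθ0) hdesc (by positivity)
        (by positivity)
    have h1 : (1 + ∑ j, (k j : ℝ)) ^ s ≤ (2 * (d + 1)) ^ s * ((k i : ℝ) / 2) ^ s := by
      rw [← Real.mul_rpow (by positivity) (by positivity)]
      refine Real.rpow_le_rpow (by positivity) ?_ hs.le
      have : (1 : ℝ) ≤ k i := by linarith
      linarith
    have h2 : R i ≤ ∑ j, R j := Finset.single_le_sum (fun j _ => hR0 j) (Finset.mem_univ i)
    have h3 : 0 ≤ (2 * ((d : ℝ) + 1)) ^ s := by positivity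
    have h4 : 0 ≤ (1 + 2 * (d : ℝ) * m) ^ s := by positivity
    calc (1 + ∑ j, (k j : ℝ)) ^ s ≤ (2 * (d + 1)) ^ s * ((k i : ℝ) / 2) ^ s := h1
      _ ≤ (2 * (d + 1)) ^ s * (∑ j, R j) := mul_le_mul_of_nonneg_left (hRi.trans h2) h3
      _ ≤ _ := by nlinarith [mul_nonneg h4 hRsum]

theorem sum_single (i : Fin d) (m : ℕ) : ∑ j, (Pi.single i m : Fin d → ℕ) j = m := by
  simp

/-- On the Sobolev ball the energies of the pure derivatives of order `⌊s⌋` are bounded. -/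
theorem tsum_rpow_mul_hermiteCoeff_weakDeriv_sq_le {s : ℝ} {f : L2Gaussian d}
    (hf : f ∈ sobolevBall d s) (i : Fin d) :
    ∑' k, ENNReal.ofReal (((∑ j, k j : ℕ) : ℝ) ^ Int.fract s *
      hermiteCoeff (weakDeriv (Pi.single i ⌊s⌋₊) f) k ^ 2) ≤
      ENNReal.ofReal (max 1 (fracConst (Int.fract s))⁻¹) := by
  obtain ⟨⟨hf1, hf2⟩, hn⟩ := hf
  -- For integer s the sum is the squared norm of a weak derivative, hence at most 1; otherwise it
  -- is the energy divided by `fracConst`.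
  by_cases hs : Int.fract s = 0
  · rw [sobolevNorm, if_pos hs] at hn
    have h1 := enorm_weakDeriv_sq_le_intSobolevNorm_sq ⌊s⌋₊ f (sum_single i ⌊s⌋₊).le
    rw [hs]
    simp only [Real.rpow_zero, one_mul]
    rw [← enorm_sq_eq_tsum]
    refine h1.trans ((pow_le_one₀ (zero_le) hn).trans ?_)
    rw [ENNReal.one_le_ofReal]
    exact le_max_left _ _
  · rw [sobolevNorm, if_neg hs] at hn
    have h0 : 0 < Int.fract s := lt_of_le_of_ne (Int.fract_nonneg s) (Ne.symm hs)
    have hc := fracConst_pos h0 (Int.fract_lt_one s)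
    have hn' : fracSeminorm d s f ≤ 1 := le_add_self.trans hn
    rw [fracSeminorm_eq hs] at hn'
    have h2 := (Finset.single_le_sum (f := fun α => (∑' k, ENNReal.ofReal
      (fracConst (Int.fract s) * ((∑ i, k i : ℕ) : ℝ) ^ Int.fract s *
        hermiteCoeff (weakDeriv α f) k ^ 2)) ^ (1 / 2 : ℝ)) (fun _ _ => zero_le)
        (show Pi.single i ⌊s⌋₊ ∈ (Finset.univ : Finset (Fin d)).piAntidiag ⌊s⌋₊ by simp)).trans hn'
    set S := ∑' k : Fin d → ℕ, ENNReal.ofReal (((∑ j, k j : ℕ) : ℝ) ^ Int.fract s *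
      hermiteCoeff (weakDeriv (Pi.single i ⌊s⌋₊) f) k ^ 2) with hS
    have h3 : (ENNReal.ofReal (fracConst (Int.fract s)) * S) ^ (1 / 2 : ℝ) ≤ 1 := by
      rw [hS, ← ENNReal.tsum_mul_left]
      simpa only [mul_assoc, ENNReal.ofReal_mul hc.le] using h2
    have h4 : ENNReal.ofReal (fracConst (Int.fract s)) * S ≤ 1 := by
      by_contra h
      exact absurd (ENNReal.one_lt_rpow (not_le.1 h) (by norm_num)) (not_lt.2 h3)
    have h5 : S ≤ ENNReal.ofReal (fracConst (Int.fract s))⁻¹ := by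
      rw [ENNReal.ofReal_inv_of_pos hc, ENNReal.le_inv_iff_mul_le, mul_comm]
      exact h4
    exact h5.trans (ENNReal.ofReal_le_ofReal (le_max_right _ _))

/-- The norm of f and the energies of its pure derivatives ∂_i^{⌊s⌋}f are bounded on the ball and
already dominate the Hermite weight; mixed derivatives are not needed. -/
theorem exists_hermiteNorm_le_of_mem_sobolevBall (hd : 1 ≤ d) {s : ℝ} (hs : 0 < s) :
    ∃ C : ℝ≥0, 0 < C ∧ ∀ f ∈ sobolevBall d s, hermiteNorm d s f ≤ C := by
  obtain ⟨C, hC, hk⟩ := exists_one_add_sum_rpow_le hd hs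
  set B := max 1 (fracConst (Int.fract s))⁻¹ with hB
  have hB0 : 0 < B := lt_of_lt_of_le one_pos (le_max_left _ _)
  have key : ∀ f ∈ sobolevBall d s, hermiteEnergy d s f ≤ ENNReal.ofReal (C * (1 + d * B)) := by
    intro f hf
    have hf1 := hf.1.1
    have hnorm : ‖f‖ₑ ^ 2 ≤ 1 := by
      have h1 := enorm_weakDeriv_sq_le_intSobolevNorm_sq ⌊s⌋₊ f (α := 0) (by simp)
      rw [weakDeriv_zero hf1] at h1
      refine h1.trans (pow_le_one₀ (zero_le) (le_trans ?_ hf.2))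
      rw [sobolevNorm]
      split_ifs
      · exact le_rfl
      · exact le_self_add
    set R : (Fin d → ℕ) → Fin d → ℝ := fun k i =>
      ((∑ j, (k - Pi.single i ⌊s⌋₊ : Fin d → ℕ) j : ℕ) : ℝ) ^ Int.fract s *
        descFactorialProd k (Pi.single i ⌊s⌋₊) with hR
    have hR0 : ∀ k i, 0 ≤ R k i := fun k i => by positivity
    have hpt : ∀ k, ENNReal.ofReal ((1 + ∑ i, (k i : ℝ)) ^ s * |hermiteCoeff f k| ^ 2) ≤
        ENNReal.ofReal C * (ENNReal.ofReal (hermiteCoeff f k ^ 2) +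
          ∑ i, ENNReal.ofReal (R k i * hermiteCoeff f k ^ 2)) := by
      intro k
      rw [← ENNReal.ofReal_sum_of_nonneg fun i _ => mul_nonneg (hR0 k i) (sq_nonneg _),
        ← ENNReal.ofReal_add (sq_nonneg _)
          (Finset.sum_nonneg fun i _ => mul_nonneg (hR0 k i) (sq_nonneg _)),
        ← ENNReal.ofReal_mul hC.le]
      refine ENNReal.ofReal_le_ofReal ?_
      rw [sq_abs, ← Finset.sum_mul]
      calc _ ≤ C * (1 + ∑ i, R k i) * hermiteCoeff f k ^ 2 :=
            mul_le_mul_of_nonneg_right (hk k) (sq_nonneg _)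
        _ = _ := by ring
    calc hermiteEnergy d s f ≤ ∑' k, ENNReal.ofReal C * (ENNReal.ofReal (hermiteCoeff f k ^ 2) +
          ∑ i, ENNReal.ofReal (R k i * hermiteCoeff f k ^ 2)) := ENNReal.tsum_le_tsum hpt
      _ = ENNReal.ofReal C * (‖f‖ₑ ^ 2 +
          ∑ i, ∑' k, ENNReal.ofReal (R k i * hermiteCoeff f k ^ 2)) := by
        rw [ENNReal.tsum_mul_left, ENNReal.tsum_add, enorm_sq_eq_tsum,
          Summable.tsum_finsetSum fun _ _ => ENNReal.summable]
      _ ≤ ENNReal.ofReal C * (1 + ∑ _i : Fin d, ENNReal.ofReal B) := by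
        gcongr with i
        have h1 := tsum_rpow_mul_hermiteCoeff_weakDeriv_sq_le hf i
        rw [tsum_mul_hermiteCoeff_weakDeriv_sq hf1 (sum_single i ⌊s⌋₊).le fun k =>
          ((∑ j, k j : ℕ) : ℝ) ^ Int.fract s] at h1
        exact h1
      _ = ENNReal.ofReal (C * (1 + d * B)) := by
        rw [ENNReal.ofReal_mul hC.le, ENNReal.ofReal_add one_pos.le (by positivity),
          ENNReal.ofReal_mul (by positivity)]
        simp
  refine ⟨((C * (1 + d * B)) ^ (1 / 2 : ℝ)).toNNReal, Real.toNNReal_pos.2 (by positivity),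
    fun f hf => ?_⟩
  rw [hermiteNorm_eq]
  refine (ENNReal.rpow_le_rpow (key f hf) (by norm_num)).trans ?_
  rw [ENNReal.ofReal_rpow_of_pos (by positivity), ENNReal.ofReal]

/-! ### Bounding Sobolev norms by Hermite norms -/

theorem one_le_one_add_sum (k : Fin d → ℕ) : 1 ≤ 1 + ∑ i, (k i : ℝ) :=
  le_add_of_nonneg_right (Finset.sum_nonneg fun _ _ => Nat.cast_nonneg _)

theorem descFactorialProd_le_rpow {m : ℕ} (k : Fin d → ℕ) {α : Fin d → ℕ} (hα : ∑ i, α i ≤ m) :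
    (descFactorialProd k α : ℝ) ≤ (1 + ∑ i, (k i : ℝ)) ^ (m : ℝ) := by
  have h1 : (descFactorialProd k α : ℝ) ≤ ((∑ i, k i : ℕ) : ℝ) ^ (∑ i, α i) := by
    exact_mod_cast descFactorialProd_le_pow k α
  rw [Real.rpow_natCast]
  refine h1.trans ((pow_le_pow_left₀ (by positivity) ?_ _).trans
    (pow_le_pow_right₀ (one_le_one_add_sum k) hα))
  push_cast
  linarith

theorem intSobolevNorm_le {s : ℝ} (hs : 0 < s) {f : L2Gaussian d}
    (hf : f ∈ intSobolevSpace d ⌊s⌋₊) :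
    intSobolevNorm d ⌊s⌋₊ f ≤ ((∑ k ∈ Finset.range (⌊s⌋₊ + 1),
      ((Finset.univ : Finset (Fin d)).piAntidiag k).card : ℕ) : ℝ≥0∞) ^ (1 / 2 : ℝ) *
        hermiteNorm d s f := by
  rw [hermiteNorm_eq, intSobolevNorm, ← ENNReal.mul_rpow_of_nonneg _ _ (by norm_num)]
  refine ENNReal.rpow_le_rpow ?_ (by norm_num)
  push_cast
  rw [Finset.sum_mul]
  refine Finset.sum_le_sum fun n hn => ?_
  rw [← nsmul_eq_mul]
  refine Finset.sum_le_card_nsmul _ _ _ fun α hα => ?_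
  have hα' : ∑ i, α i ≤ ⌊s⌋₊ := by
    rw [(Finset.mem_piAntidiag.1 hα).1]
    exact Nat.lt_succ_iff.1 (Finset.mem_range.1 hn)
  rw [ENNReal.rpow_ofNat, enorm_weakDeriv_sq hf hα']
  refine ENNReal.tsum_le_tsum fun k => ENNReal.ofReal_le_ofReal ?_
  rw [sq_abs]
  refine mul_le_mul_of_nonneg_right ((descFactorialProd_le_rpow k hα').trans ?_) (sq_nonneg _)
  exact Real.rpow_le_rpow_of_exponent_le (one_le_one_add_sum k) (Nat.floor_le hs.le)

theorem fracSeminorm_le {s : ℝ} (hs : 0 < s) (hs' : Int.fract s ≠ 0) {f : L2Gaussian d}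
    (hf : f ∈ intSobolevSpace d ⌊s⌋₊) :
    fracSeminorm d s f ≤ (((Finset.univ : Finset (Fin d)).piAntidiag ⌊s⌋₊).card *
      ENNReal.ofReal (fracConst (Int.fract s)) ^ (1 / 2 : ℝ)) * hermiteNorm d s f := by
  have h0 : 0 < Int.fract s := lt_of_le_of_ne (Int.fract_nonneg s) (Ne.symm hs')
  have hc := fracConst_pos h0 (Int.fract_lt_one s)
  rw [fracSeminorm_eq hs', hermiteNorm_eq, mul_assoc,
    ← ENNReal.mul_rpow_of_nonneg _ _ (by norm_num), ← nsmul_eq_mul]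
  refine Finset.sum_le_card_nsmul _ _ _ fun α hα => ENNReal.rpow_le_rpow ?_ (by norm_num)
  have hα' : ∑ i, α i ≤ ⌊s⌋₊ := (Finset.mem_piAntidiag.1 hα).1.le
  rw [tsum_mul_hermiteCoeff_weakDeriv_sq hf hα' fun k =>
    fracConst (Int.fract s) * ((∑ i, k i : ℕ) : ℝ) ^ Int.fract s, hermiteEnergy,
    ← ENNReal.tsum_mul_left]
  refine ENNReal.tsum_le_tsum fun k => ?_
  rw [← ENNReal.ofReal_mul hc.le]
  refine ENNReal.ofReal_le_ofReal ?_
  rw [sq_abs, ← mul_assoc]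
  refine mul_le_mul_of_nonneg_right ?_ (sq_nonneg _)
  rw [mul_assoc]
  refine mul_le_mul_of_nonneg_left ?_ hc.le
  have hpos : (0 : ℝ) < 1 + ∑ i, (k i : ℝ) := one_pos.trans_le (one_le_one_add_sum k)
  -- Splitting the exponent as ⌊s⌋ + θ lets the falling factorial and the factor |k-α|^θ be bounded
  -- separately.
  rw [← natFloor_add_fract hs.le, Real.rpow_add hpos, mul_comm, natFloor_add_fract hs.le]
  refine mul_le_mul (descFactorialProd_le_rpow k hα') ?_ (by positivity) (by positivity)
  refine Real.rpow_le_rpow (by positivity) ?_ h0.le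
  have : ((∑ i, (k - α) i : ℕ) : ℝ) ≤ ((∑ i, k i : ℕ) : ℝ) := by
    exact_mod_cast Finset.sum_le_sum fun i _ => Nat.sub_le _ _
  push_cast at this ⊢
  linarith

/-- Restricting to finite Hermite sums makes existence of weak derivatives immediate. This suffices,
since the lower bound for the widths uses only finite-dimensional polynomial spaces. -/
theorem exists_mem_sobolevBall_of_hermiteNorm_le {s : ℝ} (hs : 0 < s) :
    ∃ c : ℝ≥0, 0 < c ∧ ∀ f ∈ Submodule.span ℝ (Set.range (hermiteVec (d := d))),
      hermiteNorm d s f ≤ c → f ∈ sobolevBall d s := by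
  set A : ℝ≥0∞ := ((∑ k ∈ Finset.range (⌊s⌋₊ + 1),
      ((Finset.univ : Finset (Fin d)).piAntidiag k).card : ℕ) : ℝ≥0∞) ^ (1 / 2 : ℝ) with hA
  set A' : ℝ≥0∞ := ((Finset.univ : Finset (Fin d)).piAntidiag ⌊s⌋₊).card *
      ENNReal.ofReal (fracConst (Int.fract s)) ^ (1 / 2 : ℝ) with hA'
  have hAtop : A ≠ ⊤ := ENNReal.rpow_ne_top_of_nonneg (by norm_num) (ENNReal.natCast_ne_top _)
  have hAtop' : A' ≠ ⊤ := ENNReal.mul_ne_top (ENNReal.natCast_ne_top _)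
    (ENNReal.rpow_ne_top_of_nonneg (by norm_num) ENNReal.ofReal_ne_top)
  -- The added 1 makes T invertible without a discussion of whether A + A' vanishes.
  set T : ℝ≥0 := (A + A').toNNReal + 1 with hT
  have hT0 : T ≠ 0 := by positivity
  have hAT : A + A' ≤ T := by
    rw [hT, ENNReal.coe_add, ENNReal.coe_toNNReal (ENNReal.add_ne_top.2 ⟨hAtop, hAtop'⟩)]
    exact le_self_add
  refine ⟨T⁻¹, by positivity, fun f hf hn => ?_⟩
  have hint := mem_intSobolevSpace_of_mem_span hf ⌊s⌋₊
  have hone : (A + A') * hermiteNorm d s f ≤ 1 := by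
    refine (mul_le_mul' hAT hn).trans ?_
    rw [ENNReal.coe_inv hT0, ENNReal.mul_inv_cancel (by simpa using hT0) ENNReal.coe_ne_top]
  have h1 := intSobolevNorm_le hs hint
  rw [add_mul] at hone
  refine ⟨⟨hint, fun h => ?_⟩, ?_⟩
  · exact lt_of_le_of_lt ((fracSeminorm_le hs h hint).trans (le_add_self.trans hone))
      ENNReal.one_lt_top
  · rw [sobolevNorm]
    split_ifs with h
    · exact h1.trans (le_self_add.trans hone)
    · exact (add_le_add h1 (fracSeminorm_le hs h hint)).trans hone

end GaussianSobolev

namespace GaussianSobolev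

/-! ### Widths in Hilbert spaces -/

section HilbertWidths

variable {Y : Type*} [NormedAddCommGroup Y] [InnerProductSpace ℝ Y]

theorem finiteDimensional_of_rank_le_natCast {L : Submodule ℝ Y} {n : ℕ}
    (hL : Module.rank ℝ L ≤ (n : Cardinal)) : FiniteDimensional ℝ L :=
  Module.rank_lt_aleph0_iff.1 (hL.trans_lt Cardinal.natCast_lt_aleph0)

/-- In a Hilbert space the Kolmogorov and the linear widths coincide. -/
theorem kolmogorovWidth_eq_linearWidth (F : Set Y) (n : ℕ) :
    kolmogorovWidth F n = linearWidth F n := by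
  refine le_antisymm (le_iInf₂ fun A hA => ?_) (le_iInf₂ fun L hL => ?_)
  -- The range of A is an admissible subspace; conversely, orthogonal projection onto L is an
  -- admissible operator realizing the best approximation.
  · refine (iInf₂_le (LinearMap.range A) hA).trans (iSup₂_mono fun f _ => ?_)
    exact iInf_le (fun g : LinearMap.range A => ‖f - (g : Y)‖ₑ) ⟨A f, LinearMap.mem_range_self A f⟩
  · have := finiteDimensional_of_rank_le_natCast hL
    refine (iInf₂_le (L.starProjection : Y →ₗ[ℝ] Y) ?_).trans
      (iSup₂_mono fun f _ => le_iInf fun g => ?_)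
    · refine (Submodule.rank_mono ?_).trans hL
      rintro _ ⟨f, rfl⟩
      exact Submodule.starProjection_apply_mem L f
    · have h : ‖f - L.starProjection f‖ ≤ ‖f - g‖ := by
        rw [Submodule.starProjection_minimal]
        exact ciInf_le ⟨0, by rintro _ ⟨x, rfl⟩; exact norm_nonneg _⟩ g
      rw [← ofReal_norm, ← ofReal_norm]
      exact ENNReal.ofReal_le_ofReal h

/-- A set containing a ball of radius `r` of a subspace of dimension more than `n` has Kolmogorov
width at least `r`. -/
theorem ofReal_le_kolmogorovWidth {F : Set Y} {n : ℕ} {r : ℝ} (hr : 0 ≤ r) (V : Submodule ℝ Y)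
    [FiniteDimensional ℝ V] (hV : n < Module.finrank ℝ V) (hF : ∀ f ∈ V, ‖f‖ ≤ r → f ∈ F) :
    ENNReal.ofReal r ≤ kolmogorovWidth F n := by
  refine le_iInf₂ fun L hL => ?_
  have := finiteDimensional_of_rank_le_natCast hL
  have hLn : Module.finrank ℝ L ≤ n := Module.finrank_le_of_rank_le hL
  -- Since dim V > dim L, projecting V to L has a nontrivial kernel. A kernel vector rescaled to
  -- norm r is at distance at least r from L by Pythagoras.
  obtain ⟨f, hfV, hf0, hfL⟩ : ∃ f ∈ V, f ≠ 0 ∧ f ∈ Lᗮ := by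
    by_contra! hcon
    have hinj : Function.Injective (L.orthogonalProjectionOnto.toLinearMap ∘ₗ V.subtype) := by
      rw [← LinearMap.ker_eq_bot, LinearMap.ker_eq_bot']
      intro v hv
      by_contra hv0
      refine hcon v v.2 (fun h => hv0 (Subtype.ext h)) ?_
      exact Submodule.orthogonalProjectionOnto_eq_zero_iff.1 hv
    have := LinearMap.finrank_le_finrank_of_injective hinj
    omega
  have hfn : 0 < ‖f‖ := norm_pos_iff.2 hf0
  set h := (r / ‖f‖) • f with hh
  have hhn : ‖h‖ = r := by
    rw [hh, norm_smul, Real.norm_of_nonneg (by positivity), div_mul_cancel₀ _ hfn.ne']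
  have hhL : h ∈ Lᗮ := Submodule.smul_mem _ _ hfL
  refine le_trans ?_ (le_iSup₂ h (hF h (V.smul_mem _ hfV) hhn.le))
  refine le_iInf fun g => ?_
  rw [← ofReal_norm]
  refine ENNReal.ofReal_le_ofReal ?_
  have hin : inner ℝ h (g : Y) = 0 := Submodule.inner_left_of_mem_orthogonal g.2 hhL
  have h2 := norm_sub_sq_real h (g : Y)
  rw [hin, hhn] at h2
  exact abs_le_of_sq_le_sq' (by nlinarith [sq_nonneg ‖(g : Y)‖]) (norm_nonneg _) |>.2

end HilbertWidths

/-! ### Counting multi-indices -/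

variable {d : ℕ}

/-- The multi-indices of order less than `M`. -/
def lowIndices (d M : ℕ) : Finset (Fin d → ℕ) :=
  (Finset.range M).biUnion fun j => (Finset.univ : Finset (Fin d)).piAntidiag j

theorem mem_lowIndices {M : ℕ} {k : Fin d → ℕ} : k ∈ lowIndices d M ↔ ∑ i, k i < M := by
  simp [lowIndices]

/-- Stars and bars; writing the dimension as e+1 avoids truncated subtraction. -/
theorem card_piAntidiag_univ_fin (e j : ℕ) :
    ((Finset.univ : Finset (Fin (e + 1))).piAntidiag j).card = (j + e).choose e := by
  have h : ((Finset.univ : Finset (Fin (e + 1))).piAntidiag j).card =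
      ((Finset.univ : Finset (Fin (e + 1))).finsuppAntidiag j).card := by
    refine Finset.card_bij' (fun f _ => Finsupp.equivFunOnFinite.symm f) (fun f _ => f) ?_ ?_ ?_ ?_
    · intro f hf
      simpa [Finset.mem_finsuppAntidiag] using hf
    · intro f hf
      simpa [Finset.mem_finsuppAntidiag] using hf
    · intro f _
      rfl
    · intro f _
      ext
      rfl
  rw [h, Finset.card_finsuppAntidiag_nat_eq_choose, Finset.card_univ, Fintype.card_fin,
    show e + 1 + j - 1 = j + e by omega, ← Nat.choose_symm_add, add_comm]

/-- The hockey-stick identity gives binom(M+d, d); multiplying by d! yields the product (M+1)⋯(M+d),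
easily squeezed between d-th powers. -/
theorem card_lowIndices (hd : 1 ≤ d) (M : ℕ) :
    d ! * (lowIndices d (M + 1)).card = (M + 1).ascFactorial d := by
  obtain ⟨e, rfl⟩ : ∃ e, d = e + 1 := ⟨d - 1, by omega⟩
  rw [Nat.ascFactorial_eq_factorial_mul_choose, lowIndices, Finset.card_biUnion]
  · simp_rw [card_piAntidiag_univ_fin]
    rw [Nat.sum_range_add_choose, add_assoc]
  · intro i _ j _ hij
    refine Finset.disjoint_left.2 fun k hk hk' => hij ?_
    rw [← (Finset.mem_piAntidiag.1 hk).1, (Finset.mem_piAntidiag.1 hk').1]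

theorem pow_le_factorial_mul_card_lowIndices (hd : 1 ≤ d) (M : ℕ) :
    M ^ d ≤ d ! * (lowIndices d M).card := by
  cases M with
  | zero => simp [show d ≠ 0 by omega]
  | succ M =>
    rw [card_lowIndices hd]
    exact Nat.pow_succ_le_ascFactorial _ _

theorem factorial_mul_card_lowIndices_le (hd : 1 ≤ d) (M : ℕ) :
    d ! * (lowIndices d (M + 1)).card ≤ (M + d) ^ d := by
  rw [card_lowIndices hd]
  exact Nat.ascFactorial_le_pow_add _ _

theorem exists_lt_card_lowIndices (hd : 1 ≤ d) (n : ℕ) :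
    ∃ M, n < (lowIndices d (M + 1)).card := by
  refine ⟨d ! * n, ?_⟩
  have h1 := pow_le_factorial_mul_card_lowIndices hd (d ! * n + 1)
  have h2 : d ! * n + 1 ≤ (d ! * n + 1) ^ d := Nat.le_self_pow (by omega) _
  exact lt_of_mul_lt_mul_left (lt_of_lt_of_le (Nat.lt_succ_self _) (h2.trans h1)) (Nat.zero_le _)

open Classical in
/-- The smallest `M` with more than `n` multi-indices of order at most `M`. -/
noncomputable def widthOrder (d n : ℕ) : ℕ :=
  -- The default 0 is never reached for d ≥ 1, by `exists_lt_card_lowIndices`.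
  if h : ∃ M, n < (lowIndices d (M + 1)).card then Nat.find h else 0

/-- Together with the next bound this fixes the off-by-one: at most n indices have order below M,
but more than n have order at most M. So the (n+1)-st largest semi-axis is exactly (1+M)^{-s/2}. -/
theorem lt_card_lowIndices_widthOrder (hd : 1 ≤ d) (n : ℕ) :
    n < (lowIndices d (widthOrder d n + 1)).card := by
  classical
  rw [widthOrder, dif_pos (exists_lt_card_lowIndices hd n)]
  exact Nat.find_spec (exists_lt_card_lowIndices hd n)

theorem card_lowIndices_widthOrder_le (hd : 1 ≤ d) (n : ℕ) :
    (lowIndices d (widthOrder d n)).card ≤ n := by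
  classical
  rw [widthOrder, dif_pos (exists_lt_card_lowIndices hd n)]
  cases hM : Nat.find (exists_lt_card_lowIndices hd n) with
  | zero => simp [lowIndices]
  | succ M =>
    have := Nat.find_min (exists_lt_card_lowIndices hd n) (m := M) (by omega)
    omega

theorem widthOrder_pow_le (hd : 1 ≤ d) (n : ℕ) : widthOrder d n ^ d ≤ d ! * n :=
  (pow_le_factorial_mul_card_lowIndices hd _).trans
    (Nat.mul_le_mul_left _ (card_lowIndices_widthOrder_le hd n))

theorem factorial_mul_le_pow (hd : 1 ≤ d) (n : ℕ) : d ! * n ≤ (widthOrder d n + d) ^ d :=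
  (Nat.mul_le_mul_left _ (lt_card_lowIndices_widthOrder hd n).le).trans
    (factorial_mul_card_lowIndices_le hd _)

/-! ### Widths of sets comparable to Hermite balls -/

/-- A Bernstein inequality: coefficients of order above M vanish, and the remaining weights are at
most (1+M)^s. -/
theorem hermiteNorm_le_of_mem_span_lowIndices {s : ℝ} (hs : 0 < s) {M : ℕ} {f : L2Gaussian d}
    (hf : f ∈ Submodule.span ℝ (Set.range fun k : lowIndices d (M + 1) => hermiteVec k.1)) :
    hermiteNorm d s f ≤ ENNReal.ofReal ((1 + (M : ℝ)) ^ (s / 2) * ‖f‖) := by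
  have hzero : ∀ k : Fin d → ℕ, M < ∑ i, k i → hermiteCoeff f k = 0 := by
    intro k hk
    induction hf using Submodule.span_induction with
    | mem f hf =>
      obtain ⟨j, rfl⟩ := hf
      have hj := mem_lowIndices.1 j.2
      have hne : k ≠ j.1 := by
        rintro rfl
        omega
      rw [hermiteCoeff_eq_inner]
      exact orthonormal_hermiteVec.2 hne
    | zero => simp [hermiteCoeff_eq_inner]
    | add p q _ _ hp hq =>
      rw [hermiteCoeff_eq_inner] at hp hq ⊢
      rw [inner_add_right, hp, hq, add_zero]
    | smul c q _ hq =>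
      rw [hermiteCoeff_eq_inner] at hq ⊢
      rw [inner_smul_right, hq, mul_zero]
  have hE : hermiteEnergy d s f ≤ ENNReal.ofReal ((1 + (M : ℝ)) ^ s * ‖f‖ ^ 2) := by
    rw [ENNReal.ofReal_mul (by positivity), ENNReal.ofReal_pow (norm_nonneg _), ofReal_norm,
      enorm_sq_eq_tsum, ← ENNReal.tsum_mul_left]
    refine ENNReal.tsum_le_tsum fun k => ?_
    rw [← ENNReal.ofReal_mul (by positivity), sq_abs]
    refine ENNReal.ofReal_le_ofReal ?_
    rcases le_or_gt (∑ i, k i) M with h | h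
    · refine mul_le_mul_of_nonneg_right ?_ (sq_nonneg _)
      have : ∑ i, (k i : ℝ) ≤ M := by exact_mod_cast h
      exact Real.rpow_le_rpow (one_pos.le.trans (one_le_one_add_sum k)) (by linarith) hs.le
    · simp [hzero k h]
  rw [hermiteNorm_eq]
  refine (ENNReal.rpow_le_rpow hE (by norm_num)).trans ?_
  rw [ENNReal.ofReal_rpow_of_nonneg (by positivity) (by norm_num)]
  refine ENNReal.ofReal_le_ofReal (le_of_eq ?_)
  rw [Real.mul_rpow (by positivity) (by positivity), ← Real.rpow_mul (by positivity),
    ← Real.rpow_natCast, ← Real.rpow_mul (by positivity), Nat.cast_ofNat,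
    mul_one_div_cancel (two_ne_zero' ℝ), Real.rpow_one, mul_one_div]

/-- By the Bernstein inequality, F contains the L_2 ball of radius c(1+M)^{-s/2} of the polynomials
of degree at most M, a space of dimension above n. A general F allows use for both unit balls. -/
theorem le_kolmogorovWidth (hd : 1 ≤ d) {s : ℝ} (hs : 0 < s) {F : Set (L2Gaussian d)} {c : ℝ≥0}
    (hF : ∀ f ∈ Submodule.span ℝ (Set.range (hermiteVec (d := d))), hermiteNorm d s f ≤ c → f ∈ F)
    (n : ℕ) :
    c * ENNReal.ofReal ((1 + (widthOrder d n : ℝ)) ^ (-(s / 2))) ≤ kolmogorovWidth F n := by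
  set M := widthOrder d n
  have hpos : (0 : ℝ) < 1 + M := by positivity
  have hli : LinearIndependent ℝ fun k : lowIndices d (M + 1) => hermiteVec k.1 :=
    orthonormal_hermiteVec.linearIndependent.comp _ Subtype.val_injective
  set V := Submodule.span ℝ (Set.range fun k : lowIndices d (M + 1) => hermiteVec k.1) with hV
  have hfin : FiniteDimensional ℝ V := FiniteDimensional.span_of_finite ℝ (Set.finite_range _)
  have hrank : n < Module.finrank ℝ V := by
    rw [hV, finrank_span_eq_card hli, Fintype.card_coe]
    exact lt_card_lowIndices_widthOrder hd n
  have := ofReal_le_kolmogorovWidth (F := F) (n := n) (r := c * (1 + (M : ℝ)) ^ (-(s / 2)))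
    (by positivity) V hrank fun f hf hfr => ?_
  · rwa [ENNReal.ofReal_mul (by positivity), ENNReal.ofReal_coe_nnreal] at this
  · refine hF f ?_ ((hermiteNorm_le_of_mem_span_lowIndices hs hf).trans ?_)
    · refine Submodule.span_mono ?_ hf
      rintro _ ⟨k, rfl⟩
      exact ⟨k.1, rfl⟩
    · rw [← ENNReal.ofReal_coe_nnreal]
      refine ENNReal.ofReal_le_ofReal ?_
      calc (1 + (M : ℝ)) ^ (s / 2) * ‖f‖
          ≤ (1 + (M : ℝ)) ^ (s / 2) * (c * (1 + (M : ℝ)) ^ (-(s / 2))) :=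
            mul_le_mul_of_nonneg_left hfr (by positivity)
        _ = c := by
          rw [mul_left_comm, ← Real.rpow_add hpos]
          simp

/-- Truncating the Hermite series below order M leaves a tail whose weights are at least (1+M)^s. -/
theorem kolmogorovWidth_le (hd : 1 ≤ d) {s : ℝ} (hs : 0 < s) {F : Set (L2Gaussian d)} {C : ℝ≥0}
    (hF : ∀ f ∈ F, hermiteNorm d s f ≤ C) (n : ℕ) :
    kolmogorovWidth F n ≤
      C * ENNReal.ofReal ((1 + (widthOrder d n : ℝ)) ^ (-(s / 2))) := by
  set M := widthOrder d n
  have hpos : (0 : ℝ) < 1 + M := by positivity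
  set L := Submodule.span ℝ (Set.range fun k : lowIndices d M => hermiteVec k.1)
  have hL : Module.rank ℝ L ≤ (n : Cardinal) := by
    refine (rank_span_le _).trans (Cardinal.mk_range_le.trans ?_)
    rw [Cardinal.mk_coe_finset]
    exact_mod_cast card_lowIndices_widthOrder_le hd n
  refine (iInf₂_le L hL).trans (iSup₂_le fun f hf => ?_)
  set g : L2Gaussian d := ∑ k ∈ lowIndices d M, hermiteCoeff f k • hermiteVec k with hg
  have hgL : g ∈ L := Submodule.sum_mem _ fun k hk =>
    Submodule.smul_mem _ _ (Submodule.subset_span ⟨⟨k, hk⟩, rfl⟩)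
  refine (iInf_le _ (⟨g, hgL⟩ : L)).trans ?_
  have hcoeff : ∀ k, hermiteCoeff (f - g) k = if k ∈ lowIndices d M then 0 else hermiteCoeff f k := by
    intro k
    rw [hermiteCoeff_eq_inner, inner_sub_right, ← hermiteCoeff_eq_inner, hg, inner_sum]
    simp_rw [inner_smul_right, orthonormal_iff_ite.1 orthonormal_hermiteVec]
    simp only [mul_ite, mul_one, mul_zero, Finset.sum_ite_eq]
    split_ifs <;> simp
  have hE : ‖f - g‖ₑ ^ 2 ≤ ENNReal.ofReal ((1 + (M : ℝ)) ^ (-s)) * hermiteEnergy d s f := by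
    rw [enorm_sq_eq_tsum, hermiteEnergy, ← ENNReal.tsum_mul_left]
    refine ENNReal.tsum_le_tsum fun k => ?_
    rw [← ENNReal.ofReal_mul (by positivity), hcoeff]
    refine ENNReal.ofReal_le_ofReal ?_
    rw [sq_abs]
    have hk1 := one_le_one_add_sum k
    split_ifs with h
    · rw [zero_pow two_ne_zero]
      positivity
    · rw [← mul_assoc]
      refine le_mul_of_one_le_left (sq_nonneg _) ?_
      rw [Real.rpow_neg hpos.le, ← div_eq_inv_mul, one_le_div (by positivity)]
      refine Real.rpow_le_rpow hpos.le ?_ hs.le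
      have : (M : ℝ) ≤ ∑ i, (k i : ℝ) := by
        exact_mod_cast not_lt.1 fun h' => h (mem_lowIndices.2 h')
      linarith
  have hsqrt : ∀ a : ℝ≥0∞, (a ^ 2) ^ (1 / 2 : ℝ) = a := fun a => by
    rw [← ENNReal.rpow_natCast, ← ENNReal.rpow_mul]
    norm_num
  calc ‖f - g‖ₑ = (‖f - g‖ₑ ^ 2) ^ (1 / 2 : ℝ) := (hsqrt _).symm
    _ ≤ (ENNReal.ofReal ((1 + (M : ℝ)) ^ (-s)) * hermiteEnergy d s f) ^ (1 / 2 : ℝ) :=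
      ENNReal.rpow_le_rpow hE (by norm_num)
    _ = ENNReal.ofReal ((1 + (M : ℝ)) ^ (-(s / 2))) * hermiteNorm d s f := by
      rw [ENNReal.mul_rpow_of_nonneg _ _ (by norm_num), hermiteNorm_eq,
        ENNReal.ofReal_rpow_of_pos (by positivity), ← Real.rpow_mul hpos.le]
      ring_nf
    _ ≤ ENNReal.ofReal ((1 + (M : ℝ)) ^ (-(s / 2))) * C := mul_le_mul_right (hF f hf) _
    _ = _ := mul_comm _ _

/-! ### Asymptotics -/

theorem AsympOrder.symm {a b : ℕ → ℝ≥0∞} (h : AsympOrder a b) : AsympOrder b a := by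
  obtain ⟨C, hC, h⟩ := h
  exact ⟨C, hC, fun n hn => (h n hn).symm⟩

theorem AsympOrder.trans {a b c : ℕ → ℝ≥0∞} (h : AsympOrder a b) (h' : AsympOrder b c) :
    AsympOrder a c := by
  obtain ⟨C, hC, h⟩ := h
  obtain ⟨D, hD, h'⟩ := h'
  refine ⟨C * D, by positivity, fun n hn => ⟨?_, ?_⟩⟩
  · rw [ENNReal.coe_mul, mul_assoc]
    exact (h n hn).1.trans (mul_le_mul_right (h' n hn).1 _)
  · rw [ENNReal.coe_mul, mul_comm (C : ℝ≥0∞), mul_assoc]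
    exact (h' n hn).2.trans (mul_le_mul_right (h n hn).2 _)

theorem AsympOrder.of_le_of_le {a b : ℕ → ℝ≥0∞} {c C : ℝ≥0} (hc : 0 < c)
    (h1 : ∀ n, c * b n ≤ a n) (h2 : ∀ n, a n ≤ C * b n) : AsympOrder a b := by
  refine ⟨C + c⁻¹, by positivity, fun n _ => ⟨(h2 n).trans ?_, ?_⟩⟩
  · exact mul_le_mul_left (by push_cast; exact le_self_add) _
  · calc b n = ((c⁻¹ : ℝ≥0) : ℝ≥0∞) * (c * b n) := by
          rw [← mul_assoc, ← ENNReal.coe_mul, inv_mul_cancel₀ hc.ne', ENNReal.coe_one, one_mul]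
      _ ≤ ((c⁻¹ : ℝ≥0) : ℝ≥0∞) * a n := mul_le_mul_right (h1 n) _
      _ ≤ _ := mul_le_mul_left (by push_cast; exact le_add_self) _

theorem widthOrder_le_rpow (hd : 1 ≤ d) (n : ℕ) :
    (widthOrder d n : ℝ) ≤ (d ! : ℝ) ^ (1 / (d : ℝ)) * (n : ℝ) ^ (1 / (d : ℝ)) := by
  have hd0 : (d : ℝ) ≠ 0 := by positivity
  have h : ((widthOrder d n : ℝ)) ^ d ≤ (d ! : ℝ) * n := by exact_mod_cast widthOrder_pow_le hd n
  rw [← Real.mul_rpow (by positivity) (by positivity)]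
  refine le_trans (le_of_eq ?_) (Real.rpow_le_rpow (by positivity) h (by positivity))
  rw [← Real.rpow_natCast, ← Real.rpow_mul (by positivity), mul_one_div_cancel hd0, Real.rpow_one]

theorem rpow_le_widthOrder_add (hd : 1 ≤ d) (n : ℕ) :
    (d ! : ℝ) ^ (1 / (d : ℝ)) * (n : ℝ) ^ (1 / (d : ℝ)) ≤ widthOrder d n + d := by
  have hd0 : (d : ℝ) ≠ 0 := by positivity
  have h : (d ! : ℝ) * n ≤ ((widthOrder d n : ℝ) + d) ^ d := by
    exact_mod_cast factorial_mul_le_pow hd n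
  rw [← Real.mul_rpow (by positivity) (by positivity)]
  refine le_trans (Real.rpow_le_rpow (by positivity) h (by positivity)) (le_of_eq ?_)
  rw [← Real.rpow_natCast, ← Real.rpow_mul (by positivity), mul_one_div_cancel hd0, Real.rpow_one]

theorem rpow_neg_eq {n : ℕ} (s : ℝ) :
    (n : ℝ) ^ (-(s / (2 * (d : ℝ)))) = ((n : ℝ) ^ (1 / (d : ℝ))) ^ (-(s / 2)) := by
  rw [← Real.rpow_mul (by positivity)]
  congr 1
  field_simp

theorem asympOrder_rpow_widthOrder (hd : 1 ≤ d) {s : ℝ} (hs : 0 < s) :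
    AsympOrder (fun n => ENNReal.ofReal ((1 + (widthOrder d n : ℝ)) ^ (-(s / 2))))
      (fun n => ENNReal.ofReal ((n : ℝ) ^ (-(s / (2 * (d : ℝ)))))) := by
  set q : ℝ := (d ! : ℝ) ^ (1 / (d : ℝ)) with hq
  have hd1 : (1 : ℝ) ≤ d := by exact_mod_cast hd
  have hq1 : 1 ≤ q := Real.one_le_rpow (by exact_mod_cast Nat.factorial_pos d) (by positivity)
  -- With t = n^{1/d} and M = `widthOrder d n`, one constant serves both directions: t ≤ qt ≤ M+d ≤
  -- d(1+M), and 1+M ≤ 1+qt ≤ 2qt because qt ≥ 1.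
  set D : ℝ := 2 * q * d with hD
  have hD0 : 0 < D := by positivity
  have key : ∀ x y : ℝ, 0 < x → 0 < y → x ≤ D * y →
      ENNReal.ofReal (y ^ (-(s / 2))) ≤
        ((D ^ (s / 2)).toNNReal : ℝ≥0∞) * ENNReal.ofReal (x ^ (-(s / 2))) := by
    intro x y hx hy hxy
    change _ ≤ ENNReal.ofReal _ * _
    rw [← ENNReal.ofReal_mul (by positivity)]
    refine ENNReal.ofReal_le_ofReal ?_
    rw [Real.rpow_neg hx.le, Real.rpow_neg hy.le, ← div_eq_mul_inv, inv_eq_one_div,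
      div_le_div_iff₀ (by positivity) (by positivity), one_mul, ← Real.mul_rpow hD0.le hy.le]
    exact Real.rpow_le_rpow hx.le hxy (by positivity)
  refine ⟨(D ^ (s / 2)).toNNReal, Real.toNNReal_pos.2 (by positivity), fun n hn => ?_⟩
  have hn1 : (1 : ℝ) ≤ (n : ℝ) ^ (1 / (d : ℝ)) :=
    Real.one_le_rpow (by exact_mod_cast hn) (by positivity)
  have hu := widthOrder_le_rpow hd n
  have hl := rpow_le_widthOrder_add hd n
  beta_reduce
  rw [rpow_neg_eq]
  set t := (n : ℝ) ^ (1 / (d : ℝ))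
  rw [← hq] at hu hl
  have hm0 : (0 : ℝ) ≤ widthOrder d n := by positivity
  have hqt : t ≤ q * t := le_mul_of_one_le_left (by positivity) hq1
  refine ⟨key _ _ (by positivity) (by positivity) ?_, key _ _ (by positivity) (by positivity) ?_⟩
  · have : (widthOrder d n : ℝ) + d ≤ d * (1 + widthOrder d n) := by nlinarith
    have h2 : (d : ℝ) * (1 + widthOrder d n) ≤ D * (1 + widthOrder d n) := by
      refine mul_le_mul_of_nonneg_right ?_ (by positivity)
      rw [hD]
      nlinarith
    linarith
  · have h2 : 2 * q * t ≤ D * t := by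
      refine mul_le_mul_of_nonneg_right ?_ (by positivity)
      rw [hD]
      nlinarith
    nlinarith

/-- The quantity 1+M lies between q n^{1/d} + 1 - d and q n^{1/d} + 1, and the bounded shifts
disappear after division. -/
theorem tendsto_one_add_widthOrder_div (hd : 1 ≤ d) :
    Tendsto (fun n : ℕ => (1 + (widthOrder d n : ℝ)) / (n : ℝ) ^ (1 / (d : ℝ))) atTop
      (𝓝 ((d ! : ℝ) ^ (1 / (d : ℝ)))) := by
  set q : ℝ := (d ! : ℝ) ^ (1 / (d : ℝ)) with hq
  have hd0 : (0 : ℝ) < 1 / d := by positivity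
  have hinf : Tendsto (fun n : ℕ => (n : ℝ) ^ (1 / (d : ℝ))) atTop atTop :=
    (tendsto_rpow_atTop hd0).comp tendsto_natCast_atTop_atTop
  have hlim : ∀ c : ℝ, Tendsto (fun n : ℕ => q + c / (n : ℝ) ^ (1 / (d : ℝ))) atTop (𝓝 q) := by
    intro c
    simpa using (hinf.const_div_atTop c).const_add q
  refine tendsto_of_tendsto_of_tendsto_of_le_of_le' (hlim (1 - d)) (hlim 1) ?_ ?_
  · filter_upwards [eventually_ge_atTop 1] with n hn
    have hn0 : (0 : ℝ) < (n : ℝ) ^ (1 / (d : ℝ)) := by positivity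
    rw [le_div_iff₀ hn0, add_mul, div_mul_cancel₀ _ hn0.ne']
    linarith [rpow_le_widthOrder_add hd n]
  · filter_upwards [eventually_ge_atTop 1] with n hn
    have hn0 : (0 : ℝ) < (n : ℝ) ^ (1 / (d : ℝ)) := by positivity
    rw [div_le_iff₀ hn0, add_mul, div_mul_cancel₀ _ hn0.ne']
    linarith [widthOrder_le_rpow hd n]

/-- Both general bounds hold with constant 1, so the width is known exactly; this is what makes the
sharp limit accessible. -/
theorem kolmogorovWidth_hermiteBall (hd : 1 ≤ d) {s : ℝ} (hs : 0 < s) (n : ℕ) :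
    kolmogorovWidth (hermiteBall d s) n =
      ENNReal.ofReal ((1 + (widthOrder d n : ℝ)) ^ (-(s / 2))) := by
  refine le_antisymm ?_ ?_
  · simpa using kolmogorovWidth_le hd hs (F := hermiteBall d s) (C := 1)
      (fun f hf => by simpa using hf.2) n
  · simpa using le_kolmogorovWidth hd hs (F := hermiteBall d s) (c := 1)
      (fun f _ hf => ⟨lt_of_le_of_lt hf (by simp), by simpa using hf⟩) n

theorem tendsto_kolmogorovWidth_hermiteBall (hd : 1 ≤ d) {s : ℝ} (hs : 0 < s) :
    Tendsto (fun n : ℕ => kolmogorovWidth (hermiteBall d s) n /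
        ENNReal.ofReal ((n : ℝ) ^ (-(s / (2 * (d : ℝ)))))) atTop
      (𝓝 (ENNReal.ofReal ((1 / (d ! : ℝ) ^ (1 / (d : ℝ))) ^ (s / 2)))) := by
  set q : ℝ := (d ! : ℝ) ^ (1 / (d : ℝ)) with hq
  have hq0 : 0 < q := by positivity
  have h := (tendsto_one_add_widthOrder_div hd).rpow_const (p := -(s / 2)) (Or.inl hq0.ne')
  have e : q ^ (-(s / 2)) = (1 / q) ^ (s / 2) := by
    rw [one_div, Real.inv_rpow hq0.le, Real.rpow_neg hq0.le]
  rw [← hq, e] at h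
  refine (ENNReal.tendsto_ofReal h).congr' ?_
  filter_upwards [eventually_ge_atTop 1] with n hn
  have hn0 : (0 : ℝ) < (n : ℝ) ^ (1 / (d : ℝ)) := by positivity
  rw [kolmogorovWidth_hermiteBall hd hs, rpow_neg_eq, ← ENNReal.ofReal_div_of_pos (by positivity),
    Real.div_rpow (by positivity) hn0.le]

end GaussianSobolev

theorem mainTheorem2 (d : ℕ) (hd : 1 ≤ d) (s : ℝ) (hs : 0 < s) :
    (∀ n : ℕ,
      GaussianSobolev.kolmogorovWidth (GaussianSobolev.sobolevBall d s) n =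
        GaussianSobolev.linearWidth (GaussianSobolev.sobolevBall d s) n ∧
      GaussianSobolev.kolmogorovWidth (GaussianSobolev.hermiteBall d s) n =
        GaussianSobolev.linearWidth (GaussianSobolev.hermiteBall d s) n) ∧
    ∀ w : Set (GaussianSobolev.L2Gaussian d) → ℕ → ℝ≥0∞,
      w = GaussianSobolev.kolmogorovWidth ∨ w = GaussianSobolev.linearWidth →
      GaussianSobolev.AsympOrder (w (GaussianSobolev.sobolevBall d s))
        (w (GaussianSobolev.hermiteBall d s)) ∧
      GaussianSobolev.AsympOrder (w (GaussianSobolev.hermiteBall d s))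
        (fun n => ENNReal.ofReal ((n : ℝ) ^ (-(s / (2 * (d : ℝ)))))) ∧
      GaussianSobolev.AsympOrder (w (GaussianSobolev.sobolevBall d s))
        (fun n => ENNReal.ofReal ((n : ℝ) ^ (-(s / (2 * (d : ℝ)))))) ∧
      Tendsto
        (fun n : ℕ => w (GaussianSobolev.hermiteBall d s) n /
          ENNReal.ofReal ((n : ℝ) ^ (-(s / (2 * (d : ℝ))))))
        atTop
        (𝓝 (ENNReal.ofReal ((1 / (d ! : ℝ) ^ (1 / (d : ℝ))) ^ (s / 2)))) := by
  have hH := GaussianSobolev.kolmogorovWidth_hermiteBall hd hs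
  have hlin : ∀ w : Set (GaussianSobolev.L2Gaussian d) → ℕ → ℝ≥0∞,
      w = GaussianSobolev.kolmogorovWidth ∨ w = GaussianSobolev.linearWidth →
      w = GaussianSobolev.kolmogorovWidth := by
    rintro w (rfl | rfl)
    · rfl
    · ext F n
      exact (GaussianSobolev.kolmogorovWidth_eq_linearWidth F n).symm
  refine ⟨fun n => ⟨GaussianSobolev.kolmogorovWidth_eq_linearWidth _ n,
    GaussianSobolev.kolmogorovWidth_eq_linearWidth _ n⟩, fun w hw => ?_⟩
  rw [hlin w hw]
  obtain ⟨C, hC, hWC⟩ := GaussianSobolev.exists_hermiteNorm_le_of_mem_sobolevBall hd hs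
  obtain ⟨c, hc, hWc⟩ := GaussianSobolev.exists_mem_sobolevBall_of_hermiteNorm_le (d := d) hs
  have hr := GaussianSobolev.asympOrder_rpow_widthOrder hd hs
  -- The Sobolev ball is sandwiched at the level of widths, the lower inclusion being used only on
  -- polynomials.
  have hW := GaussianSobolev.AsympOrder.of_le_of_le hc
    (GaussianSobolev.le_kolmogorovWidth hd hs hWc) (GaussianSobolev.kolmogorovWidth_le hd hs hWC)
  have hHr : GaussianSobolev.AsympOrder
      (GaussianSobolev.kolmogorovWidth (GaussianSobolev.hermiteBall d s))
      (fun n => ENNReal.ofReal ((n : ℝ) ^ (-(s / (2 * (d : ℝ)))))) := by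
    rw [funext hH]
    exact hr
  exact ⟨(hW.trans hr).trans hHr.symm, hHr, hW.trans hr,
    GaussianSobolev.tendsto_kolmogorovWidth_hermiteBall hd hs⟩
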